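/- **Conventions.** $n$-fold categories and $n$-fold groupoids (iterated internal categories/groupoids in sets) are identified with their multinerves $X:(\Delta^{n})^{\mathrm{op}}\to\mathsf{Set}$; write $X_k$ for the $(n-1)$-fold object obtained by fixing the first index to be $k$. For a groupoid (in particular an equivalence relation) $G$ let $p\,G$ be its set of isomorphism classes of objects, and let $(p^{(n-1)}X)_{k_1\cdots k_{n-1}}=p\,(X_{k_1\cdots k_{n-1}*})$. * An $n$-fold category $X$ is *homotopically discrete* if each $X_{k_1\cdots k_{n-1}*}$ is an equivalence relation and $p^{(n-1)}X$ is homotopically discrete (for $n=0$: any set). Then $X^d:=p^{(0)}p^{(1)}\cdots p^{(n-1)}X$ is a set and $\gamma:X\to X^d$ denotes the canonical map. * *Groupoidal weakly globular $n$-fold categories* and *$n$-equivalences* between them are defined by simultaneous induction. For $n=1$ they are groupoids and equivalences of categories. For $n\ge 2$, an $n$-fold category $X$ is groupoidal weakly globular if $X_0$ is homotopically discrete, all $X_k$ and $p^{(n-1)}X$ are groupoidal weakly globular $(n-1)$-fold categories, and for all $k\ge 2$ the induced Segal map $X_k\to X_1\times_{X_0^d}\cdots\times_{X_0^d}X_1$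 is an $(n-1)$-equivalence. A map $f:X\to Y$ is an $n$-equivalence if $p^{(n-1)}f$ is an $(n-1)$-equivalence and, for all $a,b\in X_0^d$, the map $X(a,b)\to Y(fa,fb)$ is an $(n-1)$-equivalence, where $X(a,b)$ is the fibre of $X_1\to X_0\times X_0\to X_0^d\times X_0^d$ over $(a,b)$. * A *weakly globular $n$-fold groupoid* is a groupoidal weakly globular $n$-fold category which is an $n$-fold groupoid. Fix a set $\mathcal O$. An *$n$-track category* is a category with object set $\mathcal O$ enriched (for the cartesian product) in weakly globular $n$-fold groupoids; a morphism of $n$-track categories is an enriched functor which is the identity on $\mathcal O$, and it is an *$n$-equivalence* if it is an $n$-equivalence on all mapping objects. For an $n$-track category $X$ with $n\ge1$, let $p^{(0)}(X)_0$ be the category with object set $\mathcal O$ and with the sets $(X(a,b)_0)^d=p^{(0)}p^{(1)}\cdots p^{(n-2)}\,(X(a,b)_0)$ as sets of morphisms. **Lemma.** Let $n\ge 2$ and let $X$ be an $n$-track category with object set $\mathcal O$. Then there exist an $n$-track category $S(X)$ with the same object set $\mathcal O$, such that $p^{(0)}(S(X))_0$ is a free category (the category of paths of a graph), and an $n$-equivalence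 $v_X:S(X)\to X$. -/

import Mathlib

open CategoryTheory Opposite MonoidalCategory

universe u

namespace TrackCat

/-- Objects of the `n`-fold power of the simplex category, as the iterated product
`Δ × (Δ × ( ⋯ × 1))`. -/
@[reducible] def Idx : ℕ → Type
  | 0 => Discrete PUnit
  | n + 1 => SimplexCategory × Idx n

/-- The category structure of the `n`-fold power of the simplex category. -/
@[reducible] instance idxCategory : (n : ℕ) → Category.{0} (Idx n)
  | 0 => discreteCategory PUnit
  | n + 1 => letI := idxCategory n; CategoryTheory.prod' SimplexCategory (Idx n)

/-- `n`-fold simplicial sets. As usual, `n`-fold categories are identified with their multinerves,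
hence with particular `n`-fold simplicial sets. The category carries the cartesian (pointwise)
monoidal structure of Mathlib. -/
abbrev MSet (n : ℕ) : Type (u + 1) := (Idx n)ᵒᵖ ⥤ Type u

/-- The functor `((k₁, …, kₙ), l) ↦ (k₁, …, kₙ, l)`. -/
@[reducible] def snocF : (n : ℕ) → Idx n × SimplexCategory ⥤ Idx (n + 1)
  | 0 =>
    { obj := fun p => (p.2, p.1)
      map := fun f => (f.2, f.1) }
  | n + 1 =>
    { obj := fun p => (p.1.1, (snocF n).obj (p.1.2, p.2))
      map := fun f => (f.1.1, (snocF n).map (f.1.2, f.2))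
      map_id := fun p => congrArg (Prod.mk _) ((snocF n).map_id (p.1.2, p.2))
      map_comp := fun {a b c} f g => congrArg (Prod.mk _)
        ((snocF n).map_comp (X := (a.1.2, a.2)) (Y := (b.1.2, b.2)) (Z := (c.1.2, c.2))
          (f.1.2, f.2) (g.1.2, g.2)) }

/-- The functor `(k₁, …, kₙ, l) ↦ (k₁, …, kₙ)`. -/
@[reducible] def initF : (n : ℕ) → Idx (n + 1) ⥤ Idx n
  | 0 =>
    { obj := fun p => p.2
      map := fun f => f.2 }
  | n + 1 =>
    { obj := fun p => (p.1, (initF n).obj p.2)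
      map := fun f => (f.1, (initF n).map f.2)
      map_id := fun p => congrArg (Prod.mk _) ((initF n).map_id p.2)
      map_comp := fun f g => congrArg (Prod.mk _) ((initF n).map_comp f.2 g.2) }

/-- The `n`-fold simplicial set `X_k` obtained by fixing the first simplicial index to be `k`. -/
@[reducible] def level {n : ℕ} (k : SimplexCategory) : MSet.{u} (n + 1) ⥤ MSet.{u} n :=
  (Functor.whiskeringLeft _ _ _).obj (Prod.sectR k (Idx n)).op

/-- The simplicial structure maps `X_k ⟶ X_j` of the first direction. -/
@[reducible] def levelMap {n : ℕ} {j k : SimplexCategory} (φ : j ⟶ k) (X : MSet.{u} (n + 1)) :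
    (level k).obj X ⟶ (level j).obj X where
  app m := X.map (Quiver.Hom.op (X := ((j, m.unop) : Idx (n + 1))) (Y := (k, m.unop)) (φ, 𝟙 m.unop))
  naturality m m' f := by
    refine ((X.map_comp _ _).symm.trans ?_).trans (X.map_comp _ _)
    congr 1
    apply Quiver.Hom.unop_inj
    refine Prod.ext ?_ ?_
    · exact (Category.comp_id _).trans (Category.id_comp _).symm
    · exact (Category.id_comp _).trans (Category.comp_id _).symm

/-- The simplicial set `X_{* m₁ … mₙ}` in the first direction. -/
@[reducible] def firstLine {n : ℕ} (m : Idx n) : MSet.{u} (n + 1) ⥤ SSet.{u} :=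
  (Functor.whiskeringLeft _ _ _).obj (Prod.sectL SimplexCategory m).op

/-- The simplicial set `X_{m₁ … mₙ *}` in the last direction. -/
@[reducible] def lastLine {n : ℕ} (m : Idx n) : MSet.{u} (n + 1) ⥤ SSet.{u} :=
  (Functor.whiskeringLeft _ _ _).obj (Prod.sectR m SimplexCategory ⋙ snocF n).op

/-- Functoriality of `X_{m₁ … mₙ *}` in `(m₁, …, mₙ)`. -/
@[reducible] def lastLineMap {n : ℕ} {l m : Idx n} (f : l ⟶ m) : lastLine.{u} m ⟶ lastLine l :=
  (Functor.whiskeringLeft _ _ _).map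
    (NatTrans.op (Functor.whiskerRight
      { app := fun k => (f, 𝟙 k)
        naturality := fun _ _ _ => Prod.ext
          ((Category.id_comp _).trans (Category.comp_id _).symm)
          ((Category.comp_id _).trans (Category.id_comp _).symm) }
      (snocF n)))

theorem lastLineMap_id {n : ℕ} (m : Idx n) : lastLineMap.{u} (𝟙 m) = 𝟙 (lastLine m) := by
  ext X k x
  exact (congrArg (fun g => X.map (Quiver.Hom.op g) x) ((snocF n).map_id (m, k.unop))).trans
    (ConcreteCategory.congr_hom (X.map_id _) x)

theorem lastLineMap_comp {n : ℕ} {l m r : Idx n} (f : l ⟶ m) (g : m ⟶ r) :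
    lastLineMap.{u} (f ≫ g) = lastLineMap g ≫ lastLineMap f := by
  ext X k x
  have h : (snocF n).map (X := (l, k.unop)) (Y := (r, k.unop)) (f ≫ g, 𝟙 k.unop) =
      (snocF n).map (X := (l, k.unop)) (Y := (m, k.unop)) (f, 𝟙 k.unop) ≫
        (snocF n).map (X := (m, k.unop)) (Y := (r, k.unop)) (g, 𝟙 k.unop) := by
    rw [← (snocF n).map_comp]
    exact congrArg (snocF n).map (Prod.ext rfl (Category.comp_id _).symm)
  exact (congrArg (fun g => X.map (Quiver.Hom.op g) x) h).trans
    (ConcreteCategory.congr_hom (X.map_comp _ _) x)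

/-- The truncation `p⁽ⁿ⁾` from `(n + 1)`-fold to `n`-fold simplicial sets:
`(p⁽ⁿ⁾ X)_{m₁ … mₙ} = p (X_{m₁ … mₙ *})`, where `p K` is the set of vertices of `K` modulo
the equivalence relation generated by the edges. When `K` is the nerve of a groupoid (which is the
only case occurring for the objects considered below), `p K` is its set of isomorphism classes
of objects. -/
@[reducible] def trunc (n : ℕ) : MSet.{u} (n + 1) ⥤ MSet.{u} n where
  obj X :=
    { obj := fun m => SSet.π₀ ((lastLine m.unop).obj X)
      map := fun f => SSet.π₀Functor.map ((lastLineMap f.unop).app X)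
      map_id := fun m => by
        refine Eq.trans ?_ (SSet.π₀Functor.map_id _)
        exact congrArg (fun t => SSet.π₀Functor.map (NatTrans.app t X)) (lastLineMap_id m.unop)
      map_comp := fun f g => by
        refine Eq.trans ?_ (SSet.π₀Functor.map_comp _ _)
        exact congrArg (fun t => SSet.π₀Functor.map (NatTrans.app t X))
          (lastLineMap_comp g.unop f.unop) }
  map f :=
    { app := fun m => SSet.π₀Functor.map ((lastLine m.unop).map f)
      naturality := fun a b g => by
        refine (SSet.π₀Functor.map_comp _ _).symm.trans (Eq.trans ?_ (SSet.π₀Functor.map_comp _ _))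
        exact congrArg _ ((lastLineMap g.unop).naturality f).symm }
  map_id X := by
    ext1; ext1 m
    exact (congrArg _ ((lastLine m.unop).map_id X)).trans (SSet.π₀Functor.map_id _)
  map_comp f g := by
    ext1; ext1 m
    exact (congrArg _ ((lastLine m.unop).map_comp f g)).trans (SSet.π₀Functor.map_comp _ _)

/-- The discretization `Xᵈ = p⁽⁰⁾ p⁽¹⁾ ⋯ p⁽ⁿ⁻¹⁾ X`, a set. -/
@[reducible] def discF : (n : ℕ) → MSet.{u} n ⥤ Type u
  | 0 => (evaluation _ _).obj (op ⟨⟨⟩⟩)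
  | n + 1 => trunc n ⋙ discF n

theorem level_trunc {n} (k) (X : MSet.{u} (n+2)) : (level k).obj ((trunc (n+1)).obj X) = (trunc n).obj ((level k).obj X) := rfl

theorem levelMap_trunc (n) {j k} (φ : j ⟶ k) (X : MSet.{u} (n+2)) : levelMap φ ((trunc (n+1)).obj X) = (trunc n).map (levelMap φ X) := by
  ext1; ext1 m
  refine congrArg SSet.π₀Functor.map ?_
  ext l x
  exact congrArg (fun g => X.map (Quiver.Hom.op (X := ((j, (snocF n).obj (m.unop, l.unop)) : Idx (n+2)))
    (Y := ((k, (snocF n).obj (m.unop, l.unop)) : Idx (n+2))) (φ, g)) x) ((snocF n).map_id (m.unop, l.unop))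

/-- The canonical map `X ⟶ p⁽ⁿ⁾ X`, given at `(m₁, …, mₙ, l)` by sending an `l`-simplex of
`X_{m₁ … mₙ *}` to the class of (any of) its vertices. -/
@[reducible] def lastToDisc : (n : ℕ) → (X : MSet.{u} (n + 1)) → (m : Idx (n + 1)) →
    X.obj (op m) → ((trunc n).obj X).obj (op ((initF n).obj m))
  | 0, X, m, x => SSet.π₀.mk (X := (lastLine m.2).obj X) (X.map (Quiver.Hom.op (X := ((SimplexCategory.mk 0, m.2) : Idx 1)) (Y := m)
      (SimplexCategory.const _ _ 0, 𝟙 m.2)) x)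
  | n + 1, X, m, x => lastToDisc n ((level m.1).obj X) m.2 x

theorem lastToDisc_app : (n : ℕ) → {X Y : MSet.{u} (n + 1)} → (g : X ⟶ Y) → (m : Idx (n + 1)) →
    (x : X.obj (op m)) →
    lastToDisc n Y m (g.app _ x) = ((trunc n).map g).app _ (lastToDisc n X m x)
  | 0, _, _, g, _, x => congrArg SSet.π₀.mk (ConcreteCategory.congr_hom (g.naturality _) x).symm
  | n + 1, _, _, g, m, x => lastToDisc_app n ((level m.1).map g) m.2 x

theorem pi0_vertex (K : SSet.{u}) {k : SimplexCategory} (x : K.obj (op k)) (i : Fin (k.len + 1)) :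
    SSet.π₀.mk (K.map (SimplexCategory.const (.mk 0) k i).op x) =
      SSet.π₀.mk (K.map (SimplexCategory.const (.mk 0) k 0).op x) := by
  refine (SSet.π₀.sound (SSet.Edge.mk
    (K.map (SimplexCategory.mkOfLe (n := k.len) 0 i (Fin.zero_le i)).op x) ?_ ?_)).symm
  · refine (ConcreteCategory.congr_hom (K.map_comp _ _) x).symm.trans ?_
    refine congrArg (fun g => K.map (Quiver.Hom.op g) x) ?_
    ext j
    fin_cases j
    rfl
  · refine (ConcreteCategory.congr_hom (K.map_comp _ _) x).symm.trans ?_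
    refine congrArg (fun g => K.map (Quiver.Hom.op g) x) ?_
    ext j
    fin_cases j
    rfl

theorem map_pair {n : ℕ} (X : MSet.{u} (n + 1)) {k k' : SimplexCategory} {m m' : Idx n}
    (f : k' ⟶ k) (g : m' ⟶ m) (x : X.obj (op (k, m))) :
    X.map (Quiver.Hom.op (X := ((k', m') : Idx (n + 1))) (Y := (k, m)) (f, g)) x =
      (levelMap f X).app (op m') (((level k).obj X).map g.op x) := by
  refine Eq.trans ?_ (ConcreteCategory.congr_hom (X.map_comp _ _) x)
  exact congrArg (fun t => X.map (Quiver.Hom.op t) x)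
    (Prod.ext (Category.comp_id _).symm (Category.id_comp _).symm)

theorem lastToDisc_map : (n : ℕ) → (X : MSet.{u} (n + 1)) → {m m' : Idx (n + 1)} → (f : m' ⟶ m) →
    (x : X.obj (op m)) →
    lastToDisc n X m' (X.map f.op x) =
      ((trunc n).obj X).map ((initF n).map f).op (lastToDisc n X m x)
  | 0, X, (k, ⟨⟨⟩⟩), (k', ⟨⟨⟩⟩), (f, g), x => by
      obtain rfl : g = 𝟙 _ := Subsingleton.elim _ _
      refine Eq.trans ?_ (ConcreteCategory.congr_hom (((trunc 0).obj X).map_id _) _).symm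
      refine Eq.trans ?_ (pi0_vertex ((firstLine (n := 0) ⟨⟨⟩⟩).obj X) x (f.toOrderHom 0))
      refine congrArg SSet.π₀.mk ?_
      refine (ConcreteCategory.congr_hom (X.map_comp _ _) x).symm.trans ?_
      refine congrArg (fun g => X.map (Quiver.Hom.op g) x) (Prod.ext ?_ (Subsingleton.elim _ _))
      ext j
      fin_cases j
      rfl
  | n + 1, X, (k, m), (k', m'), (f, g), x => by
      refine (congrArg (lastToDisc n _ _) (map_pair X f g x)).trans ?_
      refine (lastToDisc_app n (levelMap f X) m' (((level k).obj X).map g.op x)).trans ?_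
      refine Eq.trans ?_ (map_pair ((trunc (n + 1)).obj X) f ((initF n).map g) _).symm
      rw [levelMap_trunc]
      exact congrArg _ (lastToDisc_map n ((level k).obj X) g x)

/-- The discretization map `γ : X ⟶ Xᵈ`, where `Xᵈ` is viewed as a constant `n`-fold simplicial
set; it is the composite of the maps `X ⟶ p⁽ⁿ⁻¹⁾ X ⟶ p⁽ⁿ⁻²⁾ p⁽ⁿ⁻¹⁾ X ⟶ ⋯`. -/
@[reducible] def discMap : (n : ℕ) → (X : MSet.{u} n) → (m : Idx n) → X.obj (op m) → (discF n).obj X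
  | 0, _, _, x => x
  | n + 1, X, m, x => discMap n ((trunc n).obj X) ((initF n).obj m) (lastToDisc n X m x)

theorem discMap_app : (n : ℕ) → {X Y : MSet.{u} n} → (g : X ⟶ Y) → (m : Idx n) →
    (x : X.obj (op m)) → discMap n Y m (g.app _ x) = (discF n).map g (discMap n X m x)
  | 0, _, _, _, _, _ => rfl
  | n + 1, _, _, g, m, x =>
      (congrArg (discMap n _ _) (lastToDisc_app n g m x)).trans (discMap_app n ((trunc n).map g) _ _)

theorem discMap_map : (n : ℕ) → (X : MSet.{u} n) → {m m' : Idx n} → (f : m' ⟶ m) →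
    (x : X.obj (op m)) → discMap n X m' (X.map f.op x) = discMap n X m x
  | 0, X, ⟨⟨⟩⟩, ⟨⟨⟩⟩, f, x => by
      obtain rfl : f = 𝟙 _ := Subsingleton.elim _ _
      exact ConcreteCategory.congr_hom (X.map_id _) x
  | n + 1, X, _, _, f, x =>
      (congrArg (discMap n _ _) (lastToDisc_map n X f x)).trans (discMap_map n ((trunc n).obj X) _ _)


theorem pi0_tensor_left {K L : SSet.{u}} {x x' : K.obj (op (.mk 0))} (e : K.Edge x x')
    (y : L.obj (op (.mk 0))) :
    SSet.π₀.mk (X := K ⊗ L) (x, y) = SSet.π₀.mk (X := K ⊗ L) (x', y) :=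
  SSet.π₀.sound (SSet.Edge.mk (X := K ⊗ L) (e.edge, (SSet.Edge.id y).edge)
    (Prod.ext e.src_eq (SSet.Edge.id y).src_eq) (Prod.ext e.tgt_eq (SSet.Edge.id y).tgt_eq))

theorem pi0_tensor_right {K L : SSet.{u}} (x : K.obj (op (.mk 0)))
    {y y' : L.obj (op (.mk 0))} (e : L.Edge y y') :
    SSet.π₀.mk (X := K ⊗ L) (x, y) = SSet.π₀.mk (X := K ⊗ L) (x, y') :=
  SSet.π₀.sound (SSet.Edge.mk (X := K ⊗ L) ((SSet.Edge.id x).edge, e.edge)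
    (Prod.ext (SSet.Edge.id x).src_eq e.src_eq) (Prod.ext (SSet.Edge.id x).tgt_eq e.tgt_eq))

/-- The comparison map `p K × p L → p (K × L)`. -/
@[reducible] def pi0Pair {K L : SSet.{u}} (p : SSet.π₀ K) (q : SSet.π₀ L) : SSet.π₀ (K ⊗ L) :=
  SSet.π₀.lift
    (fun x => SSet.π₀.lift (fun y => SSet.π₀.mk (X := K ⊗ L) (x, y))
      (fun _ _ e => pi0_tensor_right x e) q)
    (fun x x' e => by
      induction q with
      | mk y => exact pi0_tensor_left e y) p

/-- Compatibility of `p` with finite products. -/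
instance pi0Lax : SSet.π₀Functor.{u}.LaxMonoidal where
  ε := TypeCat.ofHom fun _ => SSet.π₀.mk (X := 𝟙_ SSet.{u}) PUnit.unit
  μ K L := TypeCat.ofHom fun p => pi0Pair p.1 p.2
  μ_natural_left f L := by
    ext ⟨p, q⟩
    obtain ⟨x, rfl⟩ := SSet.π₀.mk_surjective p
    obtain ⟨y, rfl⟩ := SSet.π₀.mk_surjective q
    rfl
  μ_natural_right K f := by
    ext ⟨p, q⟩
    obtain ⟨x, rfl⟩ := SSet.π₀.mk_surjective p
    obtain ⟨y, rfl⟩ := SSet.π₀.mk_surjective q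
    rfl
  associativity K L M := by
    ext ⟨⟨p, q⟩, r⟩
    obtain ⟨x, rfl⟩ := SSet.π₀.mk_surjective p
    obtain ⟨y, rfl⟩ := SSet.π₀.mk_surjective q
    obtain ⟨z, rfl⟩ := SSet.π₀.mk_surjective r
    rfl
  left_unitality K := by
    ext ⟨p, q⟩
    obtain ⟨y, rfl⟩ := SSet.π₀.mk_surjective q
    rfl
  right_unitality K := by
    ext ⟨p, q⟩
    obtain ⟨x, rfl⟩ := SSet.π₀.mk_surjective p
    rfl

/-- Compatibility of the truncation with finite products. -/
instance truncLax (n : ℕ) : (trunc.{u} n).LaxMonoidal where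
  ε :=
    { app := fun m => Functor.LaxMonoidal.ε SSet.π₀Functor
      naturality := fun _ _ _ => rfl }
  μ X Y :=
    { app := fun m =>
        Functor.LaxMonoidal.μ SSet.π₀Functor ((lastLine m.unop).obj X) ((lastLine m.unop).obj Y)
      naturality := fun _ _ f => Functor.LaxMonoidal.μ_natural SSet.π₀Functor
        ((lastLineMap f.unop).app X) ((lastLineMap f.unop).app Y) }
  μ_natural_left f Z := by
    ext1; ext1 m
    exact Functor.LaxMonoidal.μ_natural_left SSet.π₀Functor ((lastLine m.unop).map f) _
  μ_natural_right Z f := by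
    ext1; ext1 m
    exact Functor.LaxMonoidal.μ_natural_right SSet.π₀Functor _ ((lastLine m.unop).map f)
  associativity X Y Z := by
    ext1; ext1 m
    exact Functor.LaxMonoidal.associativity SSet.π₀Functor ((lastLine m.unop).obj X)
      ((lastLine m.unop).obj Y) ((lastLine m.unop).obj Z)
  left_unitality X := by
    ext1; ext1 m
    exact Functor.LaxMonoidal.left_unitality SSet.π₀Functor ((lastLine m.unop).obj X)
  right_unitality X := by
    ext1; ext1 m
    exact Functor.LaxMonoidal.right_unitality SSet.π₀Functor ((lastLine m.unop).obj X)

/-- Compatibility of the discretization with finite products. -/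
instance discLax : (n : ℕ) → (discF.{u} n).LaxMonoidal
  | 0 =>
    { ε := 𝟙 _
      μ := fun _ _ => 𝟙 _ }
  | n + 1 =>
    letI := discLax n
    inferInstanceAs (trunc n ⋙ discF n).LaxMonoidal

/-- The fibre `X(a, b)` at `(a, b)` of `X₁ ⟶ X₀ × X₀ ⟶ X₀ᵈ × X₀ᵈ`, where the first map is
`(d₀, d₁)` and the second one is `γ × γ`. -/
@[reducible] def homFib {n : ℕ} (X : MSet.{u} (n + 1)) (a b : (discF n).obj ((level (.mk 0)).obj X)) :
    MSet.{u} n where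
  obj m :=
    { x : ((level (.mk 1)).obj X).obj m //
      discMap n _ m.unop ((levelMap (SimplexCategory.δ 0) X).app m x) = a ∧
      discMap n _ m.unop ((levelMap (SimplexCategory.δ 1) X).app m x) = b }
  map {m m'} f := TypeCat.ofHom fun x => ⟨((level (.mk 1)).obj X).map f x.1, by
    constructor
    · rw [NatTrans.naturality_apply]
      exact (discMap_map n _ f.unop _).trans x.2.1
    · rw [NatTrans.naturality_apply]
      exact (discMap_map n _ f.unop _).trans x.2.2⟩
  map_id m := by
    ext x
    exact ConcreteCategory.congr_hom (((level (.mk 1)).obj X).map_id m) x.1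
  map_comp f g := by
    ext x
    exact ConcreteCategory.congr_hom (((level (.mk 1)).obj X).map_comp f g) x.1

theorem levelMap_naturality {n : ℕ} {j k : SimplexCategory} (φ : j ⟶ k) {X Y : MSet.{u} (n + 1)}
    (f : X ⟶ Y) : (level k).map f ≫ levelMap φ Y = levelMap φ X ≫ (level j).map f := by
  ext1; ext1 m
  exact (f.naturality _).symm

/-- The map `f(a, b) : X(a, b) ⟶ Y(f a, f b)` induced by `f : X ⟶ Y`. -/
def homFibMap {n : ℕ} {X Y : MSet.{u} (n + 1)} (f : X ⟶ Y)
    (a b : (discF n).obj ((level (.mk 0)).obj X)) :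
    homFib X a b ⟶ homFib Y ((discF n).map ((level (.mk 0)).map f) a)
      ((discF n).map ((level (.mk 0)).map f) b) where
  app m := TypeCat.ofHom fun x => ⟨((level (.mk 1)).map f).app m x.1, by
    have h (i : Fin 2) : (levelMap (SimplexCategory.δ i) Y).app m (((level (.mk 1)).map f).app m x.1) =
        ((level (.mk 0)).map f).app m ((levelMap (SimplexCategory.δ i) X).app m x.1) :=
      ConcreteCategory.congr_hom (NatTrans.congr_app (levelMap_naturality (SimplexCategory.δ i) f) m) x.1
    constructor
    · rw [h]
      exact (discMap_app n _ _ _).trans (congrArg _ x.2.1)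
    · rw [h]
      exact (discMap_app n _ _ _).trans (congrArg _ x.2.2)⟩
  naturality m m' g := by
    ext x
    exact ConcreteCategory.congr_hom (((level (.mk 1)).map f).naturality g) x.1

/-- `n`-equivalences, by induction: `f : X ⟶ Y` is an `(n + 1)`-equivalence if all the maps
`f(a, b) : X(a, b) ⟶ Y(f a, f b)`, for `a b ∈ X₀ᵈ`, are `n`-equivalences, and `p⁽ⁿ⁾ f` is an
`n`-equivalence. The induction starts with the bijections of sets; for nerves of groupoids, the
case `n = 1` then says: fully faithful, and bijective on isomorphism classes of objects, that is,
an equivalence of categories. -/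
def IsEquiv : (n : ℕ) → {X Y : MSet.{u} n} → (X ⟶ Y) → Prop
  | 0, _, _, f => ∀ m, Function.Bijective (f.app m)
  | n + 1, _, _, f => (∀ a b, IsEquiv n (homFibMap f a b)) ∧ IsEquiv n ((trunc n).map f)

/-- The iterated fibre product `X₁ ×_{X₀ᵈ} ⋯ ×_{X₀ᵈ} X₁` of `k` copies of `X₁`, formed along
`γ d₀` and `γ d₁`. -/
@[reducible] def segalObj {n : ℕ} (X : MSet.{u} (n + 1)) (k : ℕ) : MSet.{u} n where
  obj m :=
    { x : Fin k → ((level (.mk 1)).obj X).obj m //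
      ∀ (i : ℕ) (h : i + 1 < k),
        discMap n _ m.unop ((levelMap (SimplexCategory.δ 0) X).app m (x ⟨i, by omega⟩)) =
        discMap n _ m.unop ((levelMap (SimplexCategory.δ 1) X).app m (x ⟨i + 1, h⟩)) }
  map {m m'} f := TypeCat.ofHom fun x => ⟨fun i => ((level (.mk 1)).obj X).map f (x.1 i), by
    intro i h
    rw [NatTrans.naturality_apply, NatTrans.naturality_apply]
    exact (discMap_map n _ f.unop _).trans ((x.2 i h).trans (discMap_map n _ f.unop _).symm)⟩
  map_id m := by
    ext x i
    exact ConcreteCategory.congr_hom (((level (.mk 1)).obj X).map_id m) (x.1 i)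
  map_comp f g := by
    ext x i
    exact ConcreteCategory.congr_hom (((level (.mk 1)).obj X).map_comp f g) (x.1 i)

theorem levelMap_comp {n : ℕ} {i j k : SimplexCategory} (φ : i ⟶ j) (ψ : j ⟶ k)
    (X : MSet.{u} (n + 1)) : levelMap (φ ≫ ψ) X = levelMap ψ X ≫ levelMap φ X := by
  ext1; ext1 m
  refine Eq.trans ?_ (X.map_comp _ _)
  exact congrArg (fun t => X.map (Quiver.Hom.op t)) (Prod.ext rfl (Category.comp_id _).symm)

/-- The induced Segal map `X_k ⟶ X₁ ×_{X₀ᵈ} ⋯ ×_{X₀ᵈ} X₁`, whose components are induced by the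
edges `i → i + 1` of `[k]`. -/
def segalMap {n : ℕ} (X : MSet.{u} (n + 1)) (k : ℕ) :
    (level (.mk k)).obj X ⟶ segalObj X k where
  app m := TypeCat.ofHom fun x => ⟨fun i => (levelMap (SimplexCategory.mkOfSucc i) X).app m x, by
    intro i h
    refine congrArg _ ?_
    refine (ConcreteCategory.congr_hom (NatTrans.congr_app (levelMap_comp _ _ X) m) x).symm.trans ?_
    refine Eq.trans ?_ (ConcreteCategory.congr_hom (NatTrans.congr_app (levelMap_comp _ _ X) m) x)
    refine congrArg (fun t => (levelMap t X).app m x) ?_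
    ext j
    fin_cases j
    rfl⟩
  naturality m m' f := by
    ext x i
    exact ConcreteCategory.congr_hom ((levelMap (SimplexCategory.mkOfSucc i) X).naturality f) x

/-- Nerves of groupoids: the strict Segal condition characterizes nerves of categories, and every
morphism is required to have an inverse. -/
def IsGroupoidNerve (K : SSet.{u}) : Prop :=
  K.IsStrictSegal ∧
    ∀ (x y : K.obj (op (.mk 0))) (e : K.Edge x y), Nonempty e.InvStruct

/-- Nerves of equivalence relations: categories with at most one morphism between any two objects,
in which existence of a morphism is a symmetric relation. -/
def IsEquivRelNerve (K : SSet.{u}) : Prop :=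
  K.IsStrictSegal ∧
    (∀ x y : K.obj (op (.mk 0)), Subsingleton (K.Edge x y)) ∧
    (∀ x y : K.obj (op (.mk 0)), Nonempty (K.Edge x y) → Nonempty (K.Edge y x))

/-- Multinerves of `n`-fold categories: an `(n + 1)`-fold category is a category object in `n`-fold
categories, so each `X_k` is an `n`-fold category, and the Segal maps of the first direction are
isomorphisms, that is, they are bijective at each multi-index. -/
def IsNFoldCat : (n : ℕ) → MSet.{u} n → Prop
  | 0, _ => True
  | n + 1, X =>
    (∀ k, IsNFoldCat n ((level k).obj X)) ∧ ∀ m, ((firstLine m).obj X).IsStrictSegal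

/-- Multinerves of `n`-fold groupoids: groupoid objects in `(n - 1)`-fold groupoids. -/
def IsNFoldGpd : (n : ℕ) → MSet.{u} n → Prop
  | 0, _ => True
  | n + 1, X =>
    (∀ k, IsNFoldGpd n ((level k).obj X)) ∧ ∀ m, IsGroupoidNerve ((firstLine m).obj X)

/-- Homotopically discrete `n`-fold categories: sets for `n = 0`, and inductively those
`(n + 1)`-fold categories which are levelwise equivalence relations (in the last direction) and
whose truncation is homotopically discrete. -/
def IsHomotopicallyDiscrete : (n : ℕ) → MSet.{u} n → Prop
  | 0, _ => True
  | n + 1, X =>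
    IsNFoldCat (n + 1) X ∧ (∀ m, IsEquivRelNerve ((lastLine m).obj X)) ∧
      IsHomotopicallyDiscrete n ((trunc n).obj X)

/-- Groupoidal weakly globular `n`-fold categories: sets for `n = 0`, groupoids for `n = 1`, and
inductively those `n`-fold categories `X` such that `X₀` is homotopically discrete, all the `X_k`
and the truncation of `X` are groupoidal weakly globular `(n - 1)`-fold categories, and the induced
Segal maps are `(n - 1)`-equivalences. -/
def IsGCatWG : (n : ℕ) → MSet.{u} n → Prop
  | 0, _ => True
  | 1, X => IsGroupoidNerve ((firstLine (n := 0) ⟨⟨⟩⟩).obj X)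
  | n + 2, X =>
    IsNFoldCat (n + 2) X ∧
    IsHomotopicallyDiscrete (n + 1) ((level (.mk 0)).obj X) ∧
    (∀ k, IsGCatWG (n + 1) ((level k).obj X)) ∧
    IsGCatWG (n + 1) ((trunc (n + 1)).obj X) ∧
    ∀ k, 2 ≤ k → IsEquiv (n + 1) (segalMap X k)

/-- Weakly globular `n`-fold groupoids: the groupoidal weakly globular `n`-fold categories which are
`n`-fold groupoids. -/
def IsGpdWG (n : ℕ) (X : MSet.{u} n) : Prop := IsGCatWG n X ∧ IsNFoldGpd n X

/-- `n`-track categories with set of objects `O`: categories enriched in the (full, closed under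
finite products) subcategory of weakly globular `n`-fold groupoids. -/
structure NTrack (n : ℕ) (O : Type u) where
  enr : EnrichedCategory (MSet.{u} n) O
  wg : ∀ a b : O, IsGpdWG n (enr.Hom a b)

/-- Morphisms of `n`-track categories with set of objects `O`: enriched functors which are the
identity on objects. -/
structure NTrack.Hom {n : ℕ} {O : Type u} (X Y : NTrack.{u} n O) where
  map : ∀ a b : O, X.enr.Hom a b ⟶ Y.enr.Hom a b
  map_id : ∀ a : O, X.enr.id a ≫ map a a = Y.enr.id a
  map_comp : ∀ a b c : O,
    X.enr.comp a b c ≫ map a c = (map a b ⊗ₘ map b c) ≫ Y.enr.comp a b c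

/-- A morphism of `n`-track categories is an `n`-equivalence if it induces `n`-equivalences between
the mapping objects. -/
def NTrack.Hom.IsNEquiv {n : ℕ} {O : Type u} {X Y : NTrack.{u} n O} (f : X.Hom Y) : Prop :=
  ∀ a b : O, IsEquiv n (f.map a b)

/-- The functor `X ↦ X₀ᵈ`. -/
@[reducible] def discZeroF (n : ℕ) : MSet.{u} (n + 1) ⥤ Type u := level (.mk 0) ⋙ discF n

/-- The set of objects of the category obtained from an `(n + 1)`-track category `X` by applying the
functor `Y ↦ Y₀ᵈ = p⁽⁰⁾ p⁽¹⁾ ⋯ p⁽ⁿ⁻¹⁾ Y₀` to the mapping objects (a type synonym of `O`). -/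
def NTrack.DiscZero {n : ℕ} {O : Type u} (X : NTrack.{u} (n + 1) O) : Type u :=
  letI := X.enr
  TransportEnrichment (discZeroF.{u} n) O

/-- The category with object set `O` and with `X(a, b)₀ᵈ` as set of morphisms from `a` to `b`. -/
instance discZeroCategory {n : ℕ} {O : Type u} (X : NTrack.{u} (n + 1) O) : Category.{u} X.DiscZero :=
  letI := X.enr
  letI : EnrichedCategory (Type u) X.DiscZero := inferInstanceAs (EnrichedCategory (Type u) (TransportEnrichment (discZeroF.{u} n) O))
  categoryOfEnrichedCategoryType X.DiscZero

/-- A category is free if it is isomorphic to the category of paths of a graph. -/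
def IsFreeCategory (C : Type u) [Category.{u} C] : Prop :=
  ∃ (V : Type u) (_ : Quiver.{u} V) (F : Paths V ⥤ C),
    F.Full ∧ F.Faithful ∧ Function.Bijective F.obj

end TrackCat

/-! Write `C` for the category `X.DiscZero`, with morphism sets `X(a,b)_0^d`, and let `f` be the
evaluation of paths in the underlying graph of `C`. The resolution `S` replaces each mapping object
`Z = X(a,b)` by its pullback along `f` at the vertices of the first direction: `S(a,b)_k` is the
pullback of `Z_k → (Z_0^d)^(k+1)` and the power `f^(k+1)` out of tuples of paths. Composition pairs
composition in `X` with concatenation of paths, which is legitimate because evaluation is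
functorial.

Everything rests on base change along a map of constant presheaves (`IsBC`). Truncation commutes
with it, since connected components of sets are stable under such pullbacks. Hence so do the
discretization, the fibres `Z(a,b)` and the Segal fibre products, and base change preserves
homotopical discreteness, weak globularity and `n`-equivalences (`IsEquiv.baseChange`). Each level
of `S(a,b)` is such a base change, whence `IsVBC.isGCatWG`.

The projection is an isomorphism on all fibres, because fixing the endpoints fixes their labels. It
is bijective on components because `f` is surjective and labels may be changed freely along edges.
So it is an `n`-equivalence (`IsVBC.isEquiv`). Finally `S(a,b)_0^d` is the pullback of the identity
of `X(a,b)_0^d` along `f`, that is, the set of paths (`bijective_path`), so the category of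
discretized zeroth levels of `S` is free. -/

namespace TrackCat

/-! ### Simplicial sets pulled back along labels of vertices -/

/-- The `i`-th vertex of a simplex. -/
def vert {K : SSet.{u}} {n : ℕ} (x : K.obj (op (.mk n))) (i : Fin (n + 1)) : K.obj (op (.mk 0)) :=
  K.map (SimplexCategory.const (.mk 0) (.mk n) i).op x

theorem vert_map {K : SSet.{u}} {n k : ℕ} (θ : SimplexCategory.mk k ⟶ .mk n)
    (x : K.obj (op (.mk n))) (i : Fin (k + 1)) :
    vert (K.map θ.op x) i = vert x (θ.toOrderHom i) := by
  refine (ConcreteCategory.congr_hom (K.map_comp _ _) x).symm.trans ?_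
  refine congrArg (fun g => K.map (Quiver.Hom.op g) x) ?_
  ext j
  rfl

theorem vert_zero {K : SSet.{u}} (x : K.obj (op (.mk 0))) (i : Fin 1) : vert x i = x := by
  refine Eq.trans ?_ (ConcreteCategory.congr_hom (K.map_id _) x)
  refine congrArg (fun g => K.map (Quiver.Hom.op g) x) ?_
  ext j
  fin_cases j
  fin_cases i
  rfl

theorem vert_app {K L : SSet.{u}} (g : K ⟶ L) {n : ℕ} (x : K.obj (op (.mk n))) (i : Fin (n + 1)) :
    vert (g.app _ x) i = g.app _ (vert x i) :=
  (ConcreteCategory.congr_hom (g.naturality _) x).symm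

theorem vert_one_zero {K : SSet.{u}} (x : K.obj (op (.mk 1))) : vert x 0 = K.δ 1 x := by
  refine congrArg (fun g => K.map (Quiver.Hom.op g) x) ?_
  ext j
  fin_cases j
  rfl

theorem vert_one_one {K : SSet.{u}} (x : K.obj (op (.mk 1))) : vert x 1 = K.δ 0 x := by
  refine congrArg (fun g => K.map (Quiver.Hom.op g) x) ?_
  ext j
  fin_cases j
  rfl

/-- A map of simplicial sets `g : K' ⟶ K` whose simplices over a given one are the labellings of
its vertices by pairwise related elements of `Y` lying over given labels in `D`. -/
structure IsVertexPullback {K' K : SSet.{u}} (g : K' ⟶ K) {Y D : Type u} (R : Y → Y → Prop)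
    (f : Y → D) (ψ : K'.obj (op (.mk 0)) → Y) (φ : K.obj (op (.mk 0)) → D) : Prop where
  comm : ∀ x, φ (g.app _ x) = f (ψ x)
  inj : ∀ {n : ℕ} (x x' : K'.obj (op (.mk n))), g.app _ x = g.app _ x' →
    (∀ i, ψ (vert x i) = ψ (vert x' i)) → x = x'
  rel : ∀ {n : ℕ} (x : K'.obj (op (.mk n))) (i j), R (ψ (vert x i)) (ψ (vert x j))
  lift : ∀ {n : ℕ} (z : K.obj (op (.mk n))) (y : Fin (n + 1) → Y),
    (∀ i, φ (vert z i) = f (y i)) → (∀ i j, R (y i) (y j)) →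
    ∃ x, g.app _ x = z ∧ ∀ i, ψ (vert x i) = y i

namespace IsVertexPullback

variable {K' K : SSet.{u}} {g : K' ⟶ K} {Y D : Type u} {R : Y → Y → Prop}
    {f : Y → D} {ψ : K'.obj (op (.mk 0)) → Y} {φ : K.obj (op (.mk 0)) → D}

theorem inj_zero (h : IsVertexPullback g R f ψ φ) {x x' : K'.obj (op (.mk 0))}
    (h₁ : g.app _ x = g.app _ x') (h₂ : ψ x = ψ x') : x = x' :=
  h.inj x x' h₁ fun i => by rw [vert_zero, vert_zero, h₂]

theorem inj_one (h : IsVertexPullback g R f ψ φ) {x x' : K'.obj (op (.mk 1))}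
    (h₁ : g.app _ x = g.app _ x') (h₂ : K'.δ 1 x = K'.δ 1 x') (h₃ : K'.δ 0 x = K'.δ 0 x') :
    x = x' :=
  h.inj x x' h₁ fun i => by
    fin_cases i
    · exact congrArg ψ ((vert_one_zero x).trans (h₂.trans (vert_one_zero x').symm))
    · exact congrArg ψ ((vert_one_one x).trans (h₃.trans (vert_one_one x').symm))

theorem rel_of_edge (h : IsVertexPullback g R f ψ φ) {x y : K'.obj (op (.mk 0))}
    (e : K'.Edge x y) : R (ψ x) (ψ y) := by
  have := h.rel e.edge 0 1
  rwa [vert_one_zero, vert_one_one, e.src_eq, e.tgt_eq] at this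

/-- Labels of the endpoints are the only extra data on an edge upstairs, so relatedness of these
labels is the only obstruction to lifting. For `R = Eq` the labels must agree; for `R = True` there
is no obstruction. -/
theorem exists_edge (h : IsVertexPullback g R f ψ φ) (hR : Equivalence R)
    {x y : K'.obj (op (.mk 0))} (e : K.Edge (g.app _ x) (g.app _ y)) (r : R (ψ x) (ψ y)) :
    ∃ e' : K'.Edge x y, g.app _ e'.edge = e.edge := by
  obtain ⟨e', h₁, h₂⟩ := h.lift e.edge ![ψ x, ψ y]
    (fun i => by
      fin_cases i
      · exact (congrArg φ ((vert_one_zero _).trans e.src_eq)).trans (h.comm x)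
      · exact (congrArg φ ((vert_one_one _).trans e.tgt_eq)).trans (h.comm y))
    (fun i j => by
      fin_cases i <;> fin_cases j
      · exact hR.refl _
      · exact r
      · exact hR.symm r
      · exact hR.refl _)
  refine ⟨SSet.Edge.mk e' ?_ ?_, h₁⟩
  · rw [← vert_one_zero]
    refine h.inj_zero ?_ (h₂ 0)
    rw [← vert_app, h₁, vert_one_zero, e.src_eq]
  · rw [← vert_one_one]
    refine h.inj_zero ?_ (h₂ 1)
    rw [← vert_app, h₁, vert_one_one, e.tgt_eq]

/-- The 2-simplex is lifted with the labels of `x, y, z`. Its faces are the given edges because an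
edge upstairs is determined by its image and its endpoints. -/
theorem exists_compStruct (h : IsVertexPullback g R f ψ φ) (hR : Equivalence R)
    {x y z : K'.obj (op (.mk 0))} (e₁ : K'.Edge x y) (e₂ : K'.Edge y z) (e₃ : K'.Edge x z)
    (c : (e₁.map g).CompStruct (e₂.map g) (e₃.map g)) : Nonempty (e₁.CompStruct e₂ e₃) := by
  have key : ∀ i, vert c.simplex i = g.app _ (![x, y, z] i) := by
    have h₂ : ∀ j, vert (K.δ 2 c.simplex) j = _ := fun j => congrArg (vert · j) c.d₂
    have h₀ : ∀ j, vert (K.δ 0 c.simplex) j = _ := fun j => congrArg (vert · j) c.d₀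
    intro i
    fin_cases i
    · exact (vert_map (SimplexCategory.δ 2) c.simplex 0).symm.trans
        ((h₂ 0).trans ((vert_one_zero _).trans (e₁.map g).src_eq))
    · exact (vert_map (SimplexCategory.δ 2) c.simplex 1).symm.trans
        ((h₂ 1).trans ((vert_one_one _).trans (e₁.map g).tgt_eq))
    · exact (vert_map (SimplexCategory.δ 0) c.simplex 1).symm.trans
        ((h₀ 1).trans ((vert_one_one _).trans (e₂.map g).tgt_eq))
  have r₁ := h.rel_of_edge e₁
  have r₂ := h.rel_of_edge e₂
  obtain ⟨s, h₁, h₂⟩ := h.lift c.simplex (fun i => ψ (![x, y, z] i))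
    (fun i => (congrArg φ (key i)).trans (h.comm _))
    (fun i j => by
      fin_cases i <;> fin_cases j
      · exact hR.refl _
      · exact r₁
      · exact hR.trans r₁ r₂
      · exact hR.symm r₁
      · exact hR.refl _
      · exact r₂
      · exact hR.symm (hR.trans r₁ r₂)
      · exact hR.symm r₂
      · exact hR.refl _)
  have hv (i) : vert s i = ![x, y, z] i := h.inj_zero (by rw [← vert_app, h₁, key]) (h₂ i)
  have face (θ : SimplexCategory.mk 1 ⟶ .mk 2) {a b} (e : K'.Edge a b)
      (he : K.map θ.op c.simplex = g.app _ e.edge) (ha : ![x, y, z] (θ.toOrderHom 0) = a)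
      (hb : ![x, y, z] (θ.toOrderHom 1) = b) : K'.map θ.op s = e.edge := by
    refine h.inj_one ?_ ?_ ?_
    · refine (ConcreteCategory.congr_hom (g.naturality θ.op) s).trans ?_
      rw [← he, ← h₁]
      rfl
    · rw [← vert_one_zero, vert_map, hv, e.src_eq, ha]
    · rw [← vert_one_one, vert_map, hv, e.tgt_eq, hb]
  exact ⟨SSet.Edge.CompStruct.mk s (face (SimplexCategory.δ 2) e₁ c.d₂ rfl rfl)
    (face (SimplexCategory.δ 0) e₂ c.d₀ rfl rfl) (face (SimplexCategory.δ 1) e₃ c.d₁ rfl rfl)⟩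

theorem isStrictSegal (h : IsVertexPullback g R f ψ φ) (hR : Equivalence R)
    (hK : K.IsStrictSegal) : K'.IsStrictSegal where
  segal n := by
    constructor
    · intro x x' hx
      refine h.inj x x' ((hK.segal n).1 ?_) fun i => congrArg ψ (SSet.Path.congr_vertex hx i)
      refine SSet.Path.ext ?_ ?_
      · ext i
        exact (vert_app g x i).trans
          ((congrArg _ (SSet.Path.congr_vertex hx i)).trans (vert_app g x' i).symm)
      · ext i
        exact (ConcreteCategory.congr_hom (g.naturality _) x).symm.trans
          ((congrArg _ (SSet.Path.congr_arrow hx i)).trans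
            (ConcreteCategory.congr_hom (g.naturality _) x'))
    · intro p
      obtain ⟨z, hz⟩ := (hK.segal n).2 (p.map g)
      have hv (i) : vert z i = g.app _ (p.vertex i) := SSet.Path.congr_vertex hz i
      have step (i : Fin n) : R (ψ (p.vertex i.castSucc)) (ψ (p.vertex i.succ)) :=
        h.rel_of_edge (SSet.Edge.mk (p.arrow i) (p.arrow_src i) (p.arrow_tgt i))
      -- Only consecutive vertices of a path are known to be related; transitivity from the vertex 0
      -- gives the pairwise relation that `lift` demands.
      have base (i : Fin (n + 1)) : R (ψ (p.vertex 0)) (ψ (p.vertex i)) := by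
        induction i using Fin.induction with
        | zero => exact hR.refl _
        | succ i hi => exact hR.trans hi (step i)
      obtain ⟨x, h₁, h₂⟩ := h.lift z (fun i => ψ (p.vertex i))
        (fun i => (congrArg φ (hv i)).trans (h.comm _))
        (fun i j => hR.trans (hR.symm (base i)) (base j))
      have hx (i) : vert x i = p.vertex i := h.inj_zero (by rw [← vert_app, h₁, hv]) (h₂ i)
      refine ⟨x, SSet.Path.ext (funext hx) (funext fun i => ?_)⟩
      refine h.inj_one (x := K'.map (SimplexCategory.mkOfSucc i).op x) ?_ ?_ ?_
      · refine (ConcreteCategory.congr_hom (g.naturality _) x).trans ?_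
        refine (congrArg _ h₁).trans ?_
        exact SSet.Path.congr_arrow hz i
      · rw [← vert_one_zero, vert_map, hx]
        exact (p.arrow_src i).symm
      · rw [← vert_one_one, vert_map, hx]
        exact (p.arrow_tgt i).symm

theorem isGroupoidNerve (h : IsVertexPullback g R f ψ φ) (hR : Equivalence R)
    (hK : IsGroupoidNerve K) : IsGroupoidNerve K' := by
  refine ⟨h.isStrictSegal hR hK.1, fun x y e => ?_⟩
  obtain ⟨I⟩ := hK.2 _ _ (e.map g)
  obtain ⟨i, hi⟩ := h.exists_edge hR I.inv (hR.symm (h.rel_of_edge e))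
  obtain ⟨c₁⟩ := h.exists_compStruct hR e i (.id x)
    (I.homInvId.ofEq rfl hi.symm (congrArg SSet.Edge.edge (SSet.Edge.map_id x g)).symm)
  obtain ⟨c₂⟩ := h.exists_compStruct hR i e (.id y)
    (I.invHomId.ofEq hi.symm rfl (congrArg SSet.Edge.edge (SSet.Edge.map_id y g)).symm)
  exact ⟨⟨i, c₁, c₂⟩⟩

theorem isEquivRelNerve (h : IsVertexPullback g R f ψ φ) (hR : Equivalence R)
    (hK : IsEquivRelNerve K) : IsEquivRelNerve K' := by
  refine ⟨h.isStrictSegal hR hK.1, fun x y => ⟨fun e e' => ?_⟩, fun x y ⟨e⟩ => ?_⟩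
  · refine SSet.Edge.ext (h.inj_one ?_ (e.src_eq.trans e'.src_eq.symm)
      (e.tgt_eq.trans e'.tgt_eq.symm))
    exact congrArg SSet.Edge.edge ((hK.2.1 _ _).elim (e.map g) (e'.map g))
  · obtain ⟨i⟩ := hK.2.2 _ _ ⟨e.map g⟩
    exact (h.exists_edge hR i (hR.symm (h.rel_of_edge e))).nonempty

end IsVertexPullback

/-! ### Labellings and their factorization through the discretization -/

/-- Labellings of a presheaf by a constant set. -/
@[ext]
structure Lab {C : Type} [Category.{0} C] (F : Cᵒᵖ ⥤ Type u) (D : Type u) where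
  lab : ∀ m, F.obj m → D
  lab_map : ∀ {m m'} (f : m ⟶ m') (x : F.obj m), lab m' (F.map f x) = lab m x

namespace Lab

variable {C C' : Type} [Category.{0} C] [Category.{0} C'] {F : Cᵒᵖ ⥤ Type u} {D : Type u}

/-- Restriction of a labelling along a functor. -/
@[reducible] def precomp (φ : Lab F D) (G : C' ⥤ C) : Lab (G.op ⋙ F) D where
  lab m x := φ.lab _ x
  lab_map f x := φ.lab_map _ x

/-- Restriction of a labelling to a level. -/
@[reducible] def level {n : ℕ} {Z : MSet.{u} (n + 1)} (φ : Lab Z D) (k : SimplexCategory) :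
    Lab ((TrackCat.level k).obj Z) D :=
  φ.precomp (Prod.sectR k _)

/-- The labelling of the truncation. -/
@[reducible] def trunc {n : ℕ} {Z : MSet.{u} (n + 1)} (φ : Lab Z D) :
    Lab ((TrackCat.trunc n).obj Z) D where
  lab m := SSet.π₀.lift (X := (lastLine m.unop).obj Z) (fun x => φ.lab _ x) fun x y e =>
    (congrArg (φ.lab _) e.src_eq).symm.trans ((φ.lab_map _ _).trans
      ((φ.lab_map _ _).symm.trans (congrArg (φ.lab _) e.tgt_eq)))
  lab_map {m m'} f x := by
    obtain ⟨x, rfl⟩ := SSet.π₀.mk_surjective x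
    exact φ.lab_map _ x

/-- The map `Zᵈ → D` induced by a labelling. -/
@[reducible] def disc : {n : ℕ} → {Z : MSet.{u} n} → Lab Z D → (discF n).obj Z → D
  | 0, _, φ => φ.lab _
  | _ + 1, _, φ => φ.trunc.disc

theorem trunc_lastToDisc : {n : ℕ} → {Z : MSet.{u} (n + 1)} → (φ : Lab Z D) → (m : Idx (n + 1)) →
    (x : Z.obj (op m)) → φ.trunc.lab _ (lastToDisc n Z m x) = φ.lab _ x
  | 0, _, φ, _, x => φ.lab_map _ x
  | _ + 1, _, φ, m, x => trunc_lastToDisc (φ.level m.1) m.2 x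

/-- A labelling is a map to a constant presheaf, so it factors through `γ`. Labels can therefore be
read off from classes in `Zᵈ`. -/
theorem disc_discMap : {n : ℕ} → {Z : MSet.{u} n} → (φ : Lab Z D) → (m : Idx n) →
    (x : Z.obj (op m)) → φ.disc (discMap n Z m x) = φ.lab _ x
  | 0, _, _, _, _ => rfl
  | _ + 1, _, φ, m, x => (disc_discMap φ.trunc _ _).trans (trunc_lastToDisc φ m x)

end Lab

/-- The labelling of a multisimplicial set by its discretization. -/
@[reducible] def discMapLab {n : ℕ} (Z : MSet.{u} n) : Lab Z ((discF n).obj Z) where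
  lab m := discMap n Z m.unop
  lab_map f x := discMap_map n Z f.unop x

/-- A class is represented by a vertex in the last direction. The morphism `e` is built from
identities; keeping it as a datum avoids transport along the equality of multi-indices. -/
theorem exists_lastToDisc : (n : ℕ) → (X : MSet.{u} (n + 1)) → (m : Idx n) →
    (t : ((trunc n).obj X).obj (op m)) → ∃ (m' : Idx (n + 1)) (e : (initF n).obj m' ⟶ m)
      (x : X.obj (op m')), lastToDisc n X m' x = ((trunc n).obj X).map e.op t
  | 0, X, m, t => by
    obtain ⟨x, rfl⟩ := SSet.π₀.mk_surjective t
    refine ⟨(.mk 0, m), 𝟙 _, x, ?_⟩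
    refine Eq.trans ?_ (ConcreteCategory.congr_hom (((trunc 0).obj X).map_id _) _).symm
    refine congrArg SSet.π₀.mk (Eq.trans ?_ (ConcreteCategory.congr_hom (X.map_id _) x))
    refine congrArg (fun g => X.map (Quiver.Hom.op g) x) (Prod.ext ?_ rfl)
    ext j
    fin_cases j
    rfl
  | n + 1, X, (k, m), t => by
    obtain ⟨m', e, x, hx⟩ := exists_lastToDisc n ((level k).obj X) m t
    exact ⟨(k, m'), (𝟙 k, e), x, hx⟩

/-- Joint surjectivity of `γ` over all multi-indices reduces identities between elements of `Xᵈ` to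
identities between multisimplices. -/
theorem exists_discMap : (n : ℕ) → (X : MSet.{u} n) → (d : (discF n).obj X) →
    ∃ (m : Idx n) (x : X.obj (op m)), discMap n X m x = d
  | 0, _, d => ⟨_, d, rfl⟩
  | n + 1, X, d => by
    obtain ⟨m, t, ht⟩ := exists_discMap n ((trunc n).obj X) d
    obtain ⟨m', e, x, hx⟩ := exists_lastToDisc n X m t
    refine ⟨m', x, ?_⟩
    refine (congrArg (discMap n ((trunc n).obj X) _) hx).trans ?_
    exact (discMap_map n ((trunc n).obj X) e t).trans ht

theorem disc_discMapLab {n : ℕ} (Z : MSet.{u} n) (d : (discF n).obj Z) :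
    (discMapLab Z).disc d = d := by
  obtain ⟨m, x, rfl⟩ := exists_discMap n Z d
  exact (discMapLab Z).disc_discMap m x

/-! ### Base change along a map of constant presheaves -/

/-- Pointwise pullback squares of presheaves over a map of constant presheaves. -/
structure IsBC {C : Type} [Category.{0} C] {F' F : Cᵒᵖ ⥤ Type u} (g : F' ⟶ F) {Y D : Type u}
    (f : Y → D) (ψ : Lab F' Y) (φ : Lab F D) : Prop where
  comm : ∀ m x, φ.lab m (g.app m x) = f (ψ.lab m x)
  inj : ∀ m x x', g.app m x = g.app m x' → ψ.lab m x = ψ.lab m x' → x = x'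
  lift : ∀ m z y, φ.lab m z = f y → ∃ x, g.app m x = z ∧ ψ.lab m x = y

namespace IsBC

variable {C C' : Type} [Category.{0} C] [Category.{0} C'] {Y D : Type u} {f : Y → D}

theorem precomp {F' F : Cᵒᵖ ⥤ Type u} {g : F' ⟶ F} {ψ : Lab F' Y} {φ : Lab F D}
    (h : IsBC g f ψ φ) (G : C' ⥤ C) :
    IsBC (Functor.whiskerLeft G.op g) f (ψ.precomp G) (φ.precomp G) where
  comm m x := h.comm _ x
  inj m x x' := h.inj _ x x'
  lift m z y := h.lift _ z y

/-- A label is constant along a simplex, so all its vertices carry the same one: this is the case `R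
= Eq`. -/
theorem isVertexPullback {K' K : SSet.{u}} {g : K' ⟶ K} {ψ : Lab K' Y} {φ : Lab K D}
    (h : IsBC g f ψ φ) : IsVertexPullback g Eq f (ψ.lab _) (φ.lab _) where
  comm x := h.comm _ x
  inj x x' h₁ h₂ := h.inj _ x x' h₁
    ((ψ.lab_map _ x).symm.trans ((h₂ 0).trans (ψ.lab_map _ x')))
  rel x i j := (ψ.lab_map _ x).trans (ψ.lab_map _ x).symm
  lift z y h₁ h₂ := by
    obtain ⟨x, rfl, hx⟩ := h.lift _ z (y 0) ((φ.lab_map _ z).symm.trans (h₁ 0))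
    exact ⟨x, rfl, fun i => ((ψ.lab_map _ x).trans hx).trans (h₂ 0 i)⟩

theorem level {n : ℕ} {Z' Z : MSet.{u} (n + 1)} {g : Z' ⟶ Z} {ψ : Lab Z' Y} {φ : Lab Z D}
    (h : IsBC g f ψ φ) (k : SimplexCategory) : IsBC ((TrackCat.level k).map g) f
      (ψ.level k) (φ.level k) :=
  h.precomp _

/-- Components are generated by edges, so a zigzag of edges in `K` has to be lifted one edge at a
time. Labels are constant on it, hence every intermediate vertex lifts with the same label. -/
theorem pi0_inj {K' K : SSet.{u}} {g : K' ⟶ K} {ψ : Lab K' Y} {φ : Lab K D}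
    (h : IsBC g f ψ φ) (x x' : K'.obj (op (.mk 0)))
    (h₁ : SSet.π₀.mk (g.app _ x) = SSet.π₀.mk (g.app _ x')) (h₂ : ψ.lab _ x = ψ.lab _ x') :
    SSet.π₀.mk x = SSet.π₀.mk x' := by
  have hl {T : SSet.{u}} {E : Type u} (θ : Lab T E) {a b : T.obj (op (.mk 0))} (e : T.Edge a b) :
      θ.lab _ a = θ.lab _ b :=
    (congrArg (θ.lab _) e.src_eq).symm.trans ((θ.lab_map _ _).trans
      ((θ.lab_map _ _).symm.trans (congrArg (θ.lab _) e.tgt_eq)))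
  have lift {a b : K'.obj (op (.mk 0))} (e : K.Edge (g.app _ a) (g.app _ b))
      (hab : ψ.lab _ a = ψ.lab _ b) : SSet.π₀.mk a = SSet.π₀.mk b :=
    SSet.π₀.sound (h.isVertexPullback.exists_edge eq_equivalence e hab).choose
  -- The zigzag induction is packaged as a predicate on vertices of `K` that is invariant under
  -- edges, hence descends to components.
  let P : SSet.π₀ K → Prop := SSet.π₀.lift
    (fun a => ∀ w, g.app _ w = a → ψ.lab _ w = ψ.lab _ x' → SSet.π₀.mk w = SSet.π₀.mk x')
    fun a b e => propext ⟨fun H w hw hy => by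
        subst hw
        obtain ⟨w', rfl, hw'⟩ := h.lift _ a (ψ.lab _ w) ((hl φ e).trans (h.comm _ w))
        exact (lift e hw').symm.trans (H w' rfl (hw'.trans hy)),
      fun H w hw hy => by
        subst hw
        obtain ⟨w', rfl, hw'⟩ := h.lift _ b (ψ.lab _ w) ((hl φ e).symm.trans (h.comm _ w))
        exact (lift e hw'.symm).trans (H w' rfl (hw'.trans hy))⟩
  have hP : P (SSet.π₀.mk (g.app _ x')) :=
    fun w hw hy => congrArg SSet.π₀.mk (h.inj _ w x' hw hy)
  rw [← h₁] at hP
  exact hP x rfl h₂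

theorem trunc {n : ℕ} {Z' Z : MSet.{u} (n + 1)} {g : Z' ⟶ Z} {ψ : Lab Z' Y} {φ : Lab Z D}
    (h : IsBC g f ψ φ) : IsBC ((TrackCat.trunc n).map g) f ψ.trunc φ.trunc where
  comm m x := by
    obtain ⟨x, rfl⟩ := SSet.π₀.mk_surjective x
    exact h.comm _ x
  lift m z y hz := by
    obtain ⟨z, rfl⟩ := SSet.π₀.mk_surjective z
    obtain ⟨x, rfl, hx⟩ := h.lift _ z y hz
    exact ⟨SSet.π₀.mk (X := (lastLine m.unop).obj Z') x, rfl, hx⟩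
  inj m x x' h₁ h₂ := by
    obtain ⟨x, rfl⟩ := SSet.π₀.mk_surjective x
    obtain ⟨x', rfl⟩ := SSet.π₀.mk_surjective x'
    have hl : IsBC ((lastLine m.unop).map g) f (ψ.precomp _) (φ.precomp _) := h.precomp _
    exact hl.pi0_inj x x' h₁ h₂

/-- Iterating `trunc`, this and the next two lemmas say that `Z'ᵈ` is the pullback of `Zᵈ` and `Y`
over `D`. -/
theorem disc_comm : {n : ℕ} → {Z' Z : MSet.{u} n} → {g : Z' ⟶ Z} → {ψ : Lab Z' Y} →
    {φ : Lab Z D} → IsBC g f ψ φ → ∀ x, φ.disc ((discF n).map g x) = f (ψ.disc x)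
  | 0, _, _, _, _, _, h, x => h.comm _ x
  | _ + 1, _, _, _, _, _, h, x => h.trunc.disc_comm x

theorem disc_inj : {n : ℕ} → {Z' Z : MSet.{u} n} → {g : Z' ⟶ Z} → {ψ : Lab Z' Y} →
    {φ : Lab Z D} → IsBC g f ψ φ → ∀ x x', (discF n).map g x = (discF n).map g x' →
      ψ.disc x = ψ.disc x' → x = x'
  | 0, _, _, _, _, _, h, x, x', h₁, h₂ => h.inj _ x x' h₁ h₂
  | _ + 1, _, _, _, _, _, h, x, x', h₁, h₂ => h.trunc.disc_inj x x' h₁ h₂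

theorem disc_lift : {n : ℕ} → {Z' Z : MSet.{u} n} → {g : Z' ⟶ Z} → {ψ : Lab Z' Y} →
    {φ : Lab Z D} → IsBC g f ψ φ → ∀ z y, φ.disc z = f y →
      ∃ x, (discF n).map g x = z ∧ ψ.disc x = y
  | 0, _, _, _, _, _, h, z, y, hz => h.lift _ z y hz
  | _ + 1, _, _, _, _, _, h, z, y, hz => h.trunc.disc_lift z y hz

theorem isNFoldCat : {n : ℕ} → {Z' Z : MSet.{u} n} → {g : Z' ⟶ Z} → {ψ : Lab Z' Y} →
    {φ : Lab Z D} → IsBC g f ψ φ → IsNFoldCat n Z → IsNFoldCat n Z'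
  | 0, _, _, _, _, _, _, _ => trivial
  | _ + 1, _, _, _, _, _, h, hZ => ⟨fun k => (h.level k).isNFoldCat (hZ.1 k), fun m =>
      (h.precomp (Prod.sectL _ m)).isVertexPullback.isStrictSegal eq_equivalence (hZ.2 m)⟩

theorem isNFoldGpd : {n : ℕ} → {Z' Z : MSet.{u} n} → {g : Z' ⟶ Z} → {ψ : Lab Z' Y} →
    {φ : Lab Z D} → IsBC g f ψ φ → IsNFoldGpd n Z → IsNFoldGpd n Z'
  | 0, _, _, _, _, _, _, _ => trivial
  | _ + 1, _, _, _, _, _, h, hZ => ⟨fun k => (h.level k).isNFoldGpd (hZ.1 k), fun m =>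
      (h.precomp (Prod.sectL _ m)).isVertexPullback.isGroupoidNerve eq_equivalence (hZ.2 m)⟩

theorem isHomotopicallyDiscrete : {n : ℕ} → {Z' Z : MSet.{u} n} → {g : Z' ⟶ Z} → {ψ : Lab Z' Y} →
    {φ : Lab Z D} → IsBC g f ψ φ → IsHomotopicallyDiscrete n Z → IsHomotopicallyDiscrete n Z'
  | 0, _, _, _, _, _, _, _ => trivial
  | n + 1, _, _, _, _, _, h, hZ => ⟨h.isNFoldCat hZ.1, fun m =>
      (h.precomp (Prod.sectR m _ ⋙ snocF n)).isVertexPullback.isEquivRelNerve eq_equivalence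
        (hZ.2.1 m), h.trunc.isHomotopicallyDiscrete hZ.2.2⟩

end IsBC

theorem Lab.disc_map {D : Type u} : {n : ℕ} → {Z W : MSet.{u} n} → {α : Z ⟶ W} → {φ : Lab Z D} →
    {χ : Lab W D} → (∀ m x, χ.lab m (α.app m x) = φ.lab m x) →
    ∀ x, χ.disc ((discF n).map α x) = φ.disc x
  | 0, _, _, _, _, _, h, x => h _ x
  | n + 1, Z, _, α, φ, χ, h, x => Lab.disc_map (n := n) (α := (TrackCat.trunc n).map α)
      (φ := φ.trunc) (χ := χ.trunc) (fun m x => by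
        obtain ⟨x, rfl⟩ := SSet.π₀.mk_surjective x
        exact h _ x) x

/-! ### Base change of fibres and of Segal fibre products -/

/-- The map induced on fibres over endpoints that correspond to each other. -/
def homFibMapOfEq {n : ℕ} {X Y : MSet.{u} (n + 1)} (f : X ⟶ Y)
    {a b : (discF n).obj ((level (.mk 0)).obj X)} {c d : (discF n).obj ((level (.mk 0)).obj Y)}
    (hc : (discF n).map ((level (.mk 0)).map f) a = c)
    (hd : (discF n).map ((level (.mk 0)).map f) b = d) : homFib X a b ⟶ homFib Y c d where
  app m := TypeCat.ofHom fun x => ⟨((level (.mk 1)).map f).app m x.1,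
    ((homFibMap f a b).app m x).2.1.trans hc, ((homFibMap f a b).app m x).2.2.trans hd⟩
  naturality m m' g := by
    ext x
    exact ConcreteCategory.congr_hom (((level (.mk 1)).map f).naturality g) x.1

/-- The map induced on iterated fibre products. -/
def segalObjMap {n : ℕ} {X Y : MSet.{u} (n + 1)} (f : X ⟶ Y) (k : ℕ) :
    segalObj X k ⟶ segalObj Y k where
  app m := TypeCat.ofHom fun x => ⟨fun i => ((level (.mk 1)).map f).app m (x.1 i), fun i hi => by
    have h (j : Fin 2) (x) : (levelMap (SimplexCategory.δ j) Y).app m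
        (((level (.mk 1)).map f).app m x) =
        ((level (.mk 0)).map f).app m ((levelMap (SimplexCategory.δ j) X).app m x) :=
      ConcreteCategory.congr_hom
        (NatTrans.congr_app (levelMap_naturality (SimplexCategory.δ j) f) m) x
    rw [h, h]
    exact (discMap_app n _ _ _).trans ((congrArg _ (x.2 i hi)).trans (discMap_app n _ _ _).symm)⟩
  naturality m m' g := by
    ext x i
    exact ConcreteCategory.congr_hom (((level (.mk 1)).map f).naturality g) (x.1 i)

theorem segalMap_segalObjMap {n : ℕ} {X Y : MSet.{u} (n + 1)} (f : X ⟶ Y) (k : ℕ) :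
    (level (.mk k)).map f ≫ segalMap Y k = segalMap X k ≫ segalObjMap f k := by
  ext m x i
  exact ConcreteCategory.congr_hom
    (NatTrans.congr_app (levelMap_naturality (SimplexCategory.mkOfSucc i) f) m) x

namespace Lab

variable {n : ℕ} {Z : MSet.{u} (n + 1)} {D : Type u}

/-- The labelling of the fibre `Z(a, b)`. -/
@[reducible] def homFib (φ : Lab Z D) {a b : (discF n).obj ((TrackCat.level (.mk 0)).obj Z)} {y₁ y₂ : D}
    (h₁ : (φ.level (.mk 0)).disc a = y₁)
    (h₂ : (φ.level (.mk 0)).disc b = y₂) :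
    Lab (TrackCat.homFib Z a b) {y : D // y = y₁ ∧ y = y₂} where
  lab m x := ⟨φ.lab _ x.1, by
    have key (i : Fin 2) (e)
        (he : discMap n _ m.unop ((levelMap (SimplexCategory.δ i) Z).app m x.1) = e) :
        φ.lab _ x.1 = (φ.level (.mk 0)).disc e := by
      rw [← he, disc_discMap]
      exact (φ.lab_map _ _).symm
    exact ⟨(key 0 a x.2.1).trans h₁, (key 1 b x.2.2).trans h₂⟩⟩
  lab_map f x := Subtype.ext (φ.lab_map _ _)

/-- The labelling of the fibre `Z(a, b)`, without constraint on the labels. -/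
@[reducible] def homFib' (φ : Lab Z D) (a b : (discF n).obj ((TrackCat.level (.mk 0)).obj Z)) :
    Lab (TrackCat.homFib Z a b) D where
  lab m x := φ.lab _ x.1
  lab_map f x := φ.lab_map _ _

/-- The labelling of an iterated fibre product with at least one factor. -/
@[reducible] def segalObj (φ : Lab Z D) (k : ℕ) : Lab (TrackCat.segalObj Z (k + 1)) D where
  lab m x := φ.lab _ (x.1 0)
  lab_map f x := φ.lab_map _ _

/-- Consecutive factors meet in `Z₀ᵈ`, and labels factor through `Z₀ᵈ`; so all factors share the
label of the first one. -/
theorem lab_segalObj (φ : Lab Z D) {k : ℕ} {m} (x : (TrackCat.segalObj Z (k + 1)).obj m)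
    (i : Fin (k + 1)) : φ.lab _ (x.1 i) = (φ.segalObj k).lab m x := by
  induction i using Fin.induction with
  | zero => rfl
  | succ i hi =>
    refine Eq.trans ?_ hi
    have := congrArg (φ.level (.mk 0)).disc (x.2 i (by omega))
    rw [disc_discMap, disc_discMap] at this
    exact (φ.lab_map _ _).symm.trans (this.symm.trans (φ.lab_map _ _))

end Lab

namespace IsBC

variable {Y D : Type u} {f : Y → D}

/-- An element of the fibre over `(a, b)` carries both the label of `a` and that of `b`. The label
set is therefore cut down to the elements equal to both, which is empty if the two labels differ.
Conversely, a lift with this label has the right endpoints, since an element of `Z'₀ᵈ` is determined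
by its image and its label. -/
theorem homFib {n : ℕ} {Z' Z : MSet.{u} (n + 1)} {g : Z' ⟶ Z} {ψ : Lab Z' Y} {φ : Lab Z D}
    (h : IsBC g f ψ φ) {a b : (discF n).obj ((TrackCat.level (.mk 0)).obj Z')}
    {c d : (discF n).obj ((TrackCat.level (.mk 0)).obj Z)}
    (hc : (discF n).map ((TrackCat.level (.mk 0)).map g) a = c)
    (hd : (discF n).map ((TrackCat.level (.mk 0)).map g) b = d) {y₁ y₂ : Y}
    (h₁ : (ψ.level (.mk 0)).disc a = y₁)
    (h₂ : (ψ.level (.mk 0)).disc b = y₂) :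
    IsBC (homFibMapOfEq g hc hd) (fun y => f y.1) (ψ.homFib h₁ h₂) (φ.homFib' c d) where
  comm m x := h.comm _ x.1
  inj m x x' h₁ h₂ := Subtype.ext (h.inj _ _ _ (congrArg Subtype.val h₁) (congrArg Subtype.val h₂))
  lift m z y hz := by
    obtain ⟨x, hx, hy⟩ := h.lift _ z.1 y.1 hz
    have key (i : Fin 2) (e) (he : (ψ.level (.mk 0)).disc e = y.1)
        (hz : discMap n _ m.unop ((levelMap (SimplexCategory.δ i) Z).app m z.1) =
          (discF n).map ((TrackCat.level (.mk 0)).map g) e) :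
        discMap n _ m.unop ((levelMap (SimplexCategory.δ i) Z').app m x) = e := by
      refine (h.level (.mk 0)).disc_inj _ _ ?_ ?_
      · rw [← hz, ← hx, ← discMap_app]
        refine congrArg (discMap n _ m.unop) ?_
        exact (ConcreteCategory.congr_hom
          (NatTrans.congr_app (levelMap_naturality (SimplexCategory.δ i) g) m) x).symm
      · rw [he, Lab.disc_discMap, ← hy]
        exact ψ.lab_map _ _
    exact ⟨⟨x, key 0 a (h₁.trans y.2.1.symm) (z.2.1.trans hc.symm),
      key 1 b (h₂.trans y.2.2.symm) (z.2.2.trans hd.symm)⟩, Subtype.ext hx, Subtype.ext hy⟩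

theorem segalObj {n : ℕ} {Z' Z : MSet.{u} (n + 1)} {g : Z' ⟶ Z} {ψ : Lab Z' Y} {φ : Lab Z D}
    (h : IsBC g f ψ φ) (k : ℕ) :
    IsBC (segalObjMap g (k + 1)) f (ψ.segalObj k) (φ.segalObj k) where
  comm m x := h.comm _ (x.1 0)
  inj m x x' h₁ h₂ := Subtype.ext (funext fun i => h.inj _ _ _
    (congrFun (congrArg Subtype.val h₁) i)
    ((ψ.lab_segalObj x i).trans (h₂.trans (ψ.lab_segalObj x' i).symm)))
  lift m z y hz := by
    choose x hx hy using fun i => h.lift _ (z.1 i) y ((φ.lab_segalObj z i).trans hz)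
    refine ⟨⟨x, fun i hi => ?_⟩, Subtype.ext (funext hx), hy 0⟩
    refine (h.level (.mk 0)).disc_inj _ _ ?_ ?_
    · rw [← discMap_app, ← discMap_app]
      refine Eq.trans ?_ ((z.2 i hi).trans ?_)
      · rw [← hx]
        exact congrArg (discMap n _ m.unop) (ConcreteCategory.congr_hom
          (NatTrans.congr_app (levelMap_naturality (SimplexCategory.δ 0) g) m) _).symm
      · rw [← hx]
        exact congrArg (discMap n _ m.unop) (ConcreteCategory.congr_hom
          (NatTrans.congr_app (levelMap_naturality (SimplexCategory.δ 1) g) m) _)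
    · rw [Lab.disc_discMap, Lab.disc_discMap]
      exact (ψ.lab_map _ _).trans ((hy _).trans ((hy _).symm.trans (ψ.lab_map _ _).symm))

end IsBC

/-! ### Base change of equivalences and of weakly globular objects -/

/-- Base change along a map of sets preserves `n`-equivalences. -/
theorem IsEquiv.baseChange {D : Type u} : {n : ℕ} → {Y : Type u} → {f : Y → D} →
    {Z' Z W' W : MSet.{u} n} → {g : Z' ⟶ Z} → {h : W' ⟶ W} → {α' : Z' ⟶ W'} → {α : Z ⟶ W} →
    {ψ : Lab Z' Y} → {φ : Lab Z D} → {ψ' : Lab W' Y} → {φ' : Lab W D} →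
    IsBC g f ψ φ → IsBC h f ψ' φ' → α' ≫ h = g ≫ α →
    (∀ m x, ψ'.lab m (α'.app m x) = ψ.lab m x) → (∀ m x, φ'.lab m (α.app m x) = φ.lab m x) →
    IsEquiv n α → IsEquiv n α'
  | 0, _, _, _, _, _, _, g, h, α', α, ψ, φ, ψ', φ', hg, hh, sq, hψ, hφ, hα => fun m => by
    have sq' (x) : h.app m (α'.app m x) = α.app m (g.app m x) :=
      ConcreteCategory.congr_hom (NatTrans.congr_app sq m) x
    constructor
    · intro x x' hx
      refine hg.inj m x x' ((hα m).1 ?_) ?_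
      · rw [← sq', ← sq', hx]
      · rw [← hψ, hx, hψ]
    · intro w
      obtain ⟨z, hz⟩ := (hα m).2 (h.app m w)
      obtain ⟨x, rfl, hx⟩ := hg.lift m z (ψ'.lab m w) (by rw [← hφ, hz, hh.comm])
      exact ⟨x, hh.inj m _ _ ((sq' x).trans hz) ((hψ m x).trans hx)⟩
  | n + 1, _, f, Z', Z, W', W, g, h, α', α, ψ, φ, ψ', φ', hg, hh, sq, hψ, hφ, hα => by
    refine ⟨fun a b => ?_, ?_⟩
    · have hsq (e) : (discF n).map ((level (.mk 0)).map h) ((discF n).map ((level (.mk 0)).map α') e)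
          = (discF n).map ((level (.mk 0)).map α) ((discF n).map ((level (.mk 0)).map g) e) := by
        have := ConcreteCategory.congr_hom
          (congrArg (fun t => (discF n).map ((level (.mk 0)).map t)) sq) e
        rw [Functor.map_comp, Functor.map_comp, Functor.map_comp, Functor.map_comp] at this
        exact this
      have hd (e) : (ψ'.level (.mk 0)).disc
          ((discF n).map ((level (.mk 0)).map α') e) = (ψ.level (.mk 0)).disc e :=
        Lab.disc_map (n := n) (α := (level (.mk 0)).map α') (fun m x => hψ _ x) e
      -- On fibres the label set shrinks to a subtype, which is why `Y` and `f` vary in the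
      -- induction. The equalities `hsq` and `hd` match the endpoints and labels along the two
      -- composites.
      refine IsEquiv.baseChange (hg.homFib (a := a) (b := b) rfl rfl rfl rfl)
        (hh.homFib (hsq a) (hsq b) (hd a) (hd b)) ?_ (fun m x => Subtype.ext (hψ _ x.1))
        (fun m x => hφ _ x.1) (hα.1 _ _)
      ext m x
      exact ConcreteCategory.congr_hom (NatTrans.congr_app sq _) x.1
    · refine IsEquiv.baseChange hg.trunc hh.trunc ?_ (fun m x => ?_) (fun m x => ?_) hα.2
      · rw [← Functor.map_comp, ← Functor.map_comp, sq]
      · obtain ⟨x, rfl⟩ := SSet.π₀.mk_surjective x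
        exact hψ _ x
      · obtain ⟨x, rfl⟩ := SSet.π₀.mk_surjective x
        exact hφ _ x

/-- Each ingredient of weak globularity commutes with base change; in particular the Segal map
upstairs is a base change of the one downstairs. -/
theorem IsBC.isGCatWG {Y D : Type u} {f : Y → D} : {n : ℕ} → {Z' Z : MSet.{u} n} → {g : Z' ⟶ Z} →
    {ψ : Lab Z' Y} → {φ : Lab Z D} → IsBC g f ψ φ → IsGCatWG n Z → IsGCatWG n Z'
  | 0, _, _, _, _, _, _, _ => trivial
  | 1, _, _, _, _, _, h, hZ =>
      (h.precomp (Prod.sectL _ ⟨⟨⟩⟩)).isVertexPullback.isGroupoidNerve eq_equivalence hZ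
  | n + 2, Z', Z, g, ψ, φ, h, hZ => by
    refine ⟨h.isNFoldCat hZ.1, (h.level _).isHomotopicallyDiscrete hZ.2.1,
      fun k => (h.level k).isGCatWG (hZ.2.2.1 k), h.trunc.isGCatWG hZ.2.2.2.1, fun k hk => ?_⟩
    have hs := hZ.2.2.2.2 k hk
    -- The fibre product is labelled through its first factor, so at least one factor is needed.
    obtain ⟨k, rfl⟩ : ∃ j, k = j + 1 := ⟨k - 1, by omega⟩
    exact IsEquiv.baseChange (h.level (.mk (k + 1))) (h.segalObj k)
      (segalMap_segalObjMap g (k + 1)).symm (fun m x => ψ.lab_map _ _) (fun m x => φ.lab_map _ _) hs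

theorem bijective_discF_map {n : ℕ} {X Y : MSet.{u} n} {g : X ⟶ Y}
    (h : ∀ m, Function.Bijective (g.app m)) : Function.Bijective ((discF n).map g) := by
  have : IsIso g := by
    have (m : _) : IsIso (g.app m) := (isIso_iff_bijective _).2 (h m)
    exact NatIso.isIso_of_isIso_app g
  exact (isIso_iff_bijective _).1 inferInstance

theorem IsEquiv.of_bijective : {n : ℕ} → {X Y : MSet.{u} n} → {g : X ⟶ Y} →
    (∀ m, Function.Bijective (g.app m)) → IsEquiv n g
  | 0, _, _, _, h => h
  | n + 1, X, Y, g, h => by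
    refine ⟨fun a b => IsEquiv.of_bijective fun m => ⟨fun x x' hx => Subtype.ext
      ((h _).1 (congrArg Subtype.val hx)), fun y => ?_⟩, IsEquiv.of_bijective fun m => ?_⟩
    · obtain ⟨x, hx⟩ := (h _).2 y.1
      have key (i : Fin 2) (e)
          (hy : discMap n _ m.unop ((levelMap (SimplexCategory.δ i) Y).app m y.1) =
            (discF n).map ((level (.mk 0)).map g) e) :
          discMap n _ m.unop ((levelMap (SimplexCategory.δ i) X).app m x) = e := by
        refine (bijective_discF_map (g := (level (.mk 0)).map g) fun m => h _).1 ?_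
        rw [← hy, ← hx, ← discMap_app]
        exact congrArg (discMap n _ m.unop) (ConcreteCategory.congr_hom
          (NatTrans.congr_app (levelMap_naturality (SimplexCategory.δ i) g) m) x).symm
      exact ⟨⟨x, key 0 a y.2.1, key 1 b y.2.2⟩, Subtype.ext hx⟩
    · have : IsIso g := by
        have (m : _) : IsIso (g.app m) := (isIso_iff_bijective _).2 (h m)
        exact NatIso.isIso_of_isIso_app g
      have : IsIso ((trunc n).map g) := Functor.map_isIso _ _
      exact (isIso_iff_bijective _).1 (NatIso.isIso_app_of_isIso _ _)

/-! ### Pullback along labels of the vertices in the first direction -/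

/-- The labelling of `X_k` by the labels of the vertices in the first direction. -/
@[reducible] def Lab.vertices {n : ℕ} {X : MSet.{u} (n + 1)} {D : Type u}
    (φ : Lab ((TrackCat.level (.mk 0)).obj X) D) (k : SimplexCategory) :
    Lab ((TrackCat.level k).obj X) (Fin (k.len + 1) → D) where
  lab m x i := φ.lab m ((levelMap (SimplexCategory.const (.mk 0) k i) X).app m x)
  lab_map f x := funext fun i =>
    (congrArg (φ.lab _) (NatTrans.naturality_apply (levelMap _ X) f x)).trans (φ.lab_map f _)

theorem Lab.vertices_zero {n : ℕ} {X : MSet.{u} (n + 1)} {D : Type u}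
    (φ : Lab ((TrackCat.level (.mk 0)).obj X) D) (m) (x) (i) :
    (φ.vertices (.mk 0)).lab m x i = φ.lab m x :=
  congrArg (φ.lab m) (vert_zero (K := (firstLine m.unop).obj X) x i)

theorem Lab.vertices_map {n : ℕ} {X : MSet.{u} (n + 1)} {D : Type u}
    (φ : Lab ((TrackCat.level (.mk 0)).obj X) D) (m) {j k : ℕ}
    (θ : SimplexCategory.mk j ⟶ .mk k) (x : ((TrackCat.level (.mk k)).obj X).obj m) (i) :
    (φ.vertices (.mk j)).lab m ((levelMap θ X).app m x) i =
      (φ.vertices (.mk k)).lab m x (θ.toOrderHom i) :=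
  congrArg (φ.lab m) (vert_map (K := (firstLine m.unop).obj X) θ x i)

theorem Lab.vertices_one_zero {n : ℕ} {X : MSet.{u} (n + 1)} {D : Type u}
    (φ : Lab ((TrackCat.level (.mk 0)).obj X) D) (m) (x : ((TrackCat.level (.mk 1)).obj X).obj m) :
    (φ.vertices (.mk 1)).lab m x 0 = φ.lab m ((levelMap (SimplexCategory.δ 1) X).app m x) :=
  congrArg (φ.lab m) (vert_one_zero (K := (firstLine m.unop).obj X) x)

theorem Lab.vertices_one_one {n : ℕ} {X : MSet.{u} (n + 1)} {D : Type u}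
    (φ : Lab ((TrackCat.level (.mk 0)).obj X) D) (m) (x : ((TrackCat.level (.mk 1)).obj X).obj m) :
    (φ.vertices (.mk 1)).lab m x 1 = φ.lab m ((levelMap (SimplexCategory.δ 0) X).app m x) :=
  congrArg (φ.lab m) (vert_one_one (K := (firstLine m.unop).obj X) x)

theorem Lab.trunc_vertices {n : ℕ} {X : MSet.{u} (n + 2)} {D : Type u}
    (φ : Lab ((TrackCat.level (.mk 0)).obj X) D) (k : SimplexCategory) :
    Lab.vertices (X := (TrackCat.trunc (n + 1)).obj X) φ.trunc k = (φ.vertices k).trunc := by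
  ext m x i
  obtain ⟨x, rfl⟩ := SSet.π₀.mk_surjective x
  exact congrArg (fun t : (TrackCat.level k).obj ((TrackCat.trunc (n + 1)).obj X) ⟶
    (TrackCat.level (.mk 0)).obj ((TrackCat.trunc (n + 1)).obj X) =>
      φ.trunc.lab m (t.app m (SSet.π₀.mk x)))
    (levelMap_trunc n (SimplexCategory.const (.mk 0) k i) X)

/-- A map of `(n + 1)`-fold simplicial sets whose simplices over a given one are the labellings of
its vertices in the first direction compatible with given labels. -/
def IsVBC {n : ℕ} {P X : MSet.{u} (n + 1)} (g : P ⟶ X) {Y D : Type u} (f : Y → D)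
    (ψ : Lab ((level (.mk 0)).obj P) Y) (φ : Lab ((level (.mk 0)).obj X) D) : Prop :=
  ∀ k, IsBC ((level k).map g) (fun y i => f (y i)) (ψ.vertices k) (φ.vertices k)

/-- The labelling of an iterated fibre product by the sequences of labels of the vertices. -/
@[reducible] def Lab.segalVertices {n : ℕ} {X : MSet.{u} (n + 1)} {D : Type u}
    (φ : Lab ((TrackCat.level (.mk 0)).obj X) D) (k : ℕ) :
    Lab (TrackCat.segalObj X (k + 1)) (Fin (k + 1 + 1) → D) where
  lab m x := Fin.snoc (α := fun _ => D) (fun i => (φ.vertices (.mk 1)).lab m (x.1 i) 0)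
    ((φ.vertices (.mk 1)).lab m (x.1 (Fin.last k)) 1)
  lab_map f x := by
    congr 1
    · exact funext fun i => congrFun ((φ.vertices (.mk 1)).lab_map f (x.1 i)) 0
    · exact congrFun ((φ.vertices (.mk 1)).lab_map f (x.1 _)) 1

theorem Lab.segalVertices_castSucc {n : ℕ} {X : MSet.{u} (n + 1)} {D : Type u}
    (φ : Lab ((TrackCat.level (.mk 0)).obj X) D) (k : ℕ) (m)
    (x : (TrackCat.segalObj X (k + 1)).obj m) (i : Fin (k + 1)) :
    (φ.segalVertices k).lab m x i.castSucc = (φ.vertices (.mk 1)).lab m (x.1 i) 0 :=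
  Fin.snoc_castSucc (α := fun _ => D) ((φ.vertices (.mk 1)).lab m (x.1 (Fin.last k)) 1)
    (fun i => (φ.vertices (.mk 1)).lab m (x.1 i) 0) i

/-- The end of a factor and the start of the next agree in `X₀ᵈ`, hence have equal labels. So `k +
1` composable edges carry `k + 2` well-defined vertex labels, although the definition records starts
only, plus the last end. -/
theorem Lab.segalVertices_succ {n : ℕ} {X : MSet.{u} (n + 1)} {D : Type u}
    (φ : Lab ((TrackCat.level (.mk 0)).obj X) D) (k : ℕ) (m)
    (x : (TrackCat.segalObj X (k + 1)).obj m) (i : Fin (k + 1)) :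
    (φ.segalVertices k).lab m x i.succ = (φ.vertices (.mk 1)).lab m (x.1 i) 1 := by
  induction i using Fin.lastCases with
  | last =>
    exact Fin.snoc_last (α := fun _ => D) ((φ.vertices (.mk 1)).lab m (x.1 (Fin.last k)) 1)
      (fun i => (φ.vertices (.mk 1)).lab m (x.1 i) 0)
  | cast i =>
    rw [Fin.succ_castSucc, φ.segalVertices_castSucc, φ.vertices_one_zero, φ.vertices_one_one]
    have := congrArg φ.disc (x.2 i (by omega))
    rw [Lab.disc_discMap, Lab.disc_discMap] at this
    exact this.symm

namespace IsVBC

variable {Y D : Type u} {f : Y → D}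

theorem zero {n : ℕ} {P X : MSet.{u} (n + 1)} {g : P ⟶ X}
    {ψ : Lab ((level (.mk 0)).obj P) Y} {φ : Lab ((level (.mk 0)).obj X) D}
    (h : IsVBC g f ψ φ) : IsBC ((level (.mk 0)).map g) f ψ φ where
  comm m x := by
    have := congrFun ((h (.mk 0)).comm m x) 0
    rwa [Lab.vertices_zero, Lab.vertices_zero] at this
  inj m x x' h₁ h₂ := (h (.mk 0)).inj m x x' h₁ (funext fun i => by
    rw [Lab.vertices_zero, Lab.vertices_zero, h₂])
  lift m z y hz := by
    obtain ⟨x, hx, hy⟩ := (h (.mk 0)).lift m z (fun _ => y) (funext fun i => by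
      rw [Lab.vertices_zero, hz])
    exact ⟨x, hx, (Lab.vertices_zero ψ m x 0).symm.trans (congrFun hy 0)⟩

theorem trunc {n : ℕ} {P X : MSet.{u} (n + 2)} {g : P ⟶ X}
    {ψ : Lab ((level (.mk 0)).obj P) Y} {φ : Lab ((level (.mk 0)).obj X) D}
    (h : IsVBC g f ψ φ) :
    IsVBC (P := (TrackCat.trunc (n + 1)).obj P) (X := (TrackCat.trunc (n + 1)).obj X)
      ((TrackCat.trunc (n + 1)).map g) f ψ.trunc φ.trunc := fun k => by
  rw [Lab.trunc_vertices, Lab.trunc_vertices]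
  exact (h k).trunc

/-- In the first direction the labels of distinct vertices are independent, so here `R` is the total
relation; inside a fixed level the relation is equality. -/
theorem firstLine {n : ℕ} {P X : MSet.{u} (n + 1)} {g : P ⟶ X}
    {ψ : Lab ((level (.mk 0)).obj P) Y} {φ : Lab ((level (.mk 0)).obj X) D}
    (h : IsVBC g f ψ φ) (m : Idx n) : IsVertexPullback ((TrackCat.firstLine m).map g)
      (fun _ _ => True) f (ψ.lab (op m)) (φ.lab (op m)) where
  comm x := h.zero.comm (op m) x
  inj {k} x x' h₁ h₂ := (h (.mk k)).inj (op m) x x' h₁ (funext h₂)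
  rel _ _ _ := trivial
  lift {k} z y hz _ := by
    obtain ⟨x, hx, hy⟩ := (h (.mk k)).lift (op m) z y (funext hz)
    exact ⟨x, hx, congrFun hy⟩

theorem _root_.TrackCat.equivalence_true : Equivalence fun _ _ : Y => True :=
  ⟨fun _ => trivial, fun _ => trivial, fun _ _ => trivial⟩

theorem isNFoldCat {n : ℕ} {P X : MSet.{u} (n + 1)} {g : P ⟶ X}
    {ψ : Lab ((level (.mk 0)).obj P) Y} {φ : Lab ((level (.mk 0)).obj X) D}
    (h : IsVBC g f ψ φ) (hX : IsNFoldCat (n + 1) X) : IsNFoldCat (n + 1) P :=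
  ⟨fun k => (h k).isNFoldCat (hX.1 k), fun m =>
    (h.firstLine m).isStrictSegal equivalence_true (hX.2 m)⟩

theorem isNFoldGpd {n : ℕ} {P X : MSet.{u} (n + 1)} {g : P ⟶ X}
    {ψ : Lab ((level (.mk 0)).obj P) Y} {φ : Lab ((level (.mk 0)).obj X) D}
    (h : IsVBC g f ψ φ) (hX : IsNFoldGpd (n + 1) X) : IsNFoldGpd (n + 1) P :=
  ⟨fun k => (h k).isNFoldGpd (hX.1 k), fun m =>
    (h.firstLine m).isGroupoidNerve equivalence_true (hX.2 m)⟩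

theorem disc_injective {n : ℕ} {P X : MSet.{u} (n + 1)} {g : P ⟶ X}
    {ψ : Lab ((level (.mk 0)).obj P) Y} {φ : Lab ((level (.mk 0)).obj X) D}
    (h : IsVBC g f ψ φ) (hφ : Function.Injective φ.disc) : Function.Injective ψ.disc := by
  intro a b hab
  refine h.zero.disc_inj a b (hφ ?_) hab
  rw [h.zero.disc_comm, h.zero.disc_comm, hab]

theorem segalObj {n : ℕ} {P X : MSet.{u} (n + 1)} {g : P ⟶ X}
    {ψ : Lab ((level (.mk 0)).obj P) Y} {φ : Lab ((level (.mk 0)).obj X) D}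
    (h : IsVBC g f ψ φ) (k : ℕ) : IsBC (segalObjMap g (k + 1)) (fun y i => f (y i))
      (ψ.segalVertices k) (φ.segalVertices k) where
  comm m x := by
    have key (i) (j) := congrFun ((h (.mk 1)).comm m (x.1 i)) j
    funext i
    induction i using Fin.lastCases with
    | last =>
      refine (φ.segalVertices_succ k m _ (Fin.last k)).trans ((key _ 1).trans ?_)
      exact congrArg f (ψ.segalVertices_succ k m x (Fin.last k)).symm
    | cast i =>
      refine (φ.segalVertices_castSucc k m _ i).trans ((key _ 0).trans ?_)
      exact congrArg f (ψ.segalVertices_castSucc k m x i).symm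
  inj m x x' h₁ h₂ := by
    refine Subtype.ext (funext fun i => (h (.mk 1)).inj m _ _
      (congrFun (congrArg Subtype.val h₁) i) (funext fun j => ?_))
    fin_cases j
    · exact (ψ.segalVertices_castSucc k m x i).symm.trans ((congrFun h₂ i.castSucc).trans
        (ψ.segalVertices_castSucc k m x' i))
    · exact (ψ.segalVertices_succ k m x i).symm.trans ((congrFun h₂ i.succ).trans
        (ψ.segalVertices_succ k m x' i))
  lift m z y hz := by
    choose x hx hy using fun i => (h (.mk 1)).lift m (z.1 i) ![y i.castSucc, y i.succ] (by
      funext j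
      fin_cases j
      · exact (φ.segalVertices_castSucc k m z i).symm.trans (congrFun hz _)
      · exact (φ.segalVertices_succ k m z i).symm.trans (congrFun hz _))
    -- The lifted edges are composable: at each junction the classes in `P₀ᵈ` have the same image in
    -- `X₀ᵈ` and the same label, a component of `y`.
    let x' : (TrackCat.segalObj P (k + 1)).obj m := ⟨x, fun i hi => by
      refine h.zero.disc_inj _ _ ?_ ?_
      · rw [← discMap_app, ← discMap_app]
        refine Eq.trans ?_ ((z.2 i hi).trans ?_)
        · rw [← hx]
          exact congrArg (discMap n _ m.unop) (ConcreteCategory.congr_hom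
            (NatTrans.congr_app (levelMap_naturality (SimplexCategory.δ 0) g) m) _).symm
        · rw [← hx]
          exact congrArg (discMap n _ m.unop) (ConcreteCategory.congr_hom
            (NatTrans.congr_app (levelMap_naturality (SimplexCategory.δ 1) g) m) _)
      · rw [Lab.disc_discMap, Lab.disc_discMap]
        exact (ψ.vertices_one_one m _).symm.trans ((congrFun (hy _) 1).trans
          ((congrFun (hy ⟨i + 1, hi⟩) 0).symm.trans (ψ.vertices_one_zero m _)))⟩
    refine ⟨x', Subtype.ext (funext hx), funext fun i => ?_⟩
    induction i using Fin.lastCases with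
    | last => exact (ψ.segalVertices_succ k m x' (Fin.last k)).trans (congrFun (hy _) 1)
    | cast i => exact (ψ.segalVertices_castSucc k m x' i).trans (congrFun (hy _) 0)

theorem segalVertices_segalMap {n : ℕ} {X : MSet.{u} (n + 1)}
    (φ : Lab ((level (.mk 0)).obj X) D) (k : ℕ) (m) (x : ((level (.mk (k + 1))).obj X).obj m) :
    (φ.segalVertices k).lab m ((segalMap X (k + 1)).app m x) =
      (φ.vertices (.mk (k + 1))).lab m x := by
  funext i
  induction i using Fin.lastCases with
  | last =>
    refine (φ.segalVertices_succ k m _ (Fin.last k)).trans ?_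
    exact φ.vertices_map m (SimplexCategory.mkOfSucc (Fin.last k)) x 1
  | cast i =>
    refine (φ.segalVertices_castSucc k m _ i).trans ?_
    exact φ.vertices_map m (SimplexCategory.mkOfSucc i) x 0

/-- Each level of `P` is a base change along a power of `f`, so the results for `IsBC` apply
levelwise. The Segal map for `k + 1` is a base change along the power `f^(k+2)`, since it respects
the labels of all vertices. -/
theorem isGCatWG : {n : ℕ} → {P X : MSet.{u} (n + 1)} → {g : P ⟶ X} →
    {ψ : Lab ((level (.mk 0)).obj P) Y} → {φ : Lab ((level (.mk 0)).obj X) D} →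
    IsVBC g f ψ φ → IsGCatWG (n + 1) X → IsGCatWG (n + 1) P
  | 0, _, _, _, _, _, h, hX => (h.firstLine ⟨⟨⟩⟩).isGroupoidNerve equivalence_true hX
  | n + 1, P, X, g, ψ, φ, h, hX => by
    refine ⟨h.isNFoldCat hX.1, (h _).isHomotopicallyDiscrete hX.2.1,
      fun k => (h k).isGCatWG (hX.2.2.1 k), h.trunc.isGCatWG hX.2.2.2.1, fun k hk => ?_⟩
    have hs := hX.2.2.2.2 k hk
    obtain ⟨k, rfl⟩ : ∃ j, k = j + 1 := ⟨k - 1, by omega⟩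
    exact IsEquiv.baseChange (h (.mk (k + 1))) (h.segalObj k)
      (segalMap_segalObjMap g (k + 1)).symm (segalVertices_segalMap ψ k)
      (segalVertices_segalMap φ k) hs

/-- Fixing `a` and `b` in `P₀ᵈ` fixes the labels of both endpoints, and nothing else distinguishes
the fibres of `P` and `X`. -/
theorem bijective_homFibMap {n : ℕ} {P X : MSet.{u} (n + 1)} {g : P ⟶ X}
    {ψ : Lab ((level (.mk 0)).obj P) Y} {φ : Lab ((level (.mk 0)).obj X) D}
    (h : IsVBC g f ψ φ) (a b) (m) :
    Function.Bijective ((homFibMap g a b).app m) := by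
  -- The face `d₀`, lying over `a`, is the vertex 1, and `d₁`, lying over `b`, is the vertex 0;
  -- hence the reversed order.
  have end₁ (x : (homFib P a b).obj m) : (ψ.vertices (.mk 1)).lab m x.1 = ![ψ.disc b, ψ.disc a] := by
    funext j
    fin_cases j
    · refine (ψ.vertices_one_zero m x.1).trans ?_
      rw [← ψ.disc_discMap, x.2.2]
      rfl
    · refine (ψ.vertices_one_one m x.1).trans ?_
      rw [← ψ.disc_discMap, x.2.1]
      rfl
  constructor
  · intro x x' hx
    exact Subtype.ext ((h (.mk 1)).inj m _ _ (congrArg Subtype.val hx)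
      ((end₁ x).trans (end₁ x').symm))
  · intro z
    obtain ⟨x, hx, hy⟩ := (h (.mk 1)).lift m z.1 ![ψ.disc b, ψ.disc a] (by
      funext j
      fin_cases j
      · refine (φ.vertices_one_zero m z.1).trans ?_
        rw [← φ.disc_discMap, z.2.2, h.zero.disc_comm]
        rfl
      · refine (φ.vertices_one_one m z.1).trans ?_
        rw [← φ.disc_discMap, z.2.1, h.zero.disc_comm]
        rfl)
    have key (i : Fin 2) (e) (he : ψ.lab m ((levelMap (SimplexCategory.δ i) P).app m x) = ψ.disc e)
        (hz : discMap n _ m.unop ((levelMap (SimplexCategory.δ i) X).app m z.1) =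
          (discF n).map ((level (.mk 0)).map g) e) :
        discMap n _ m.unop ((levelMap (SimplexCategory.δ i) P).app m x) = e := by
      refine h.zero.disc_inj _ _ ?_ ((ψ.disc_discMap _ _).trans he)
      rw [← hz, ← hx, ← discMap_app]
      exact congrArg (discMap n _ m.unop) (ConcreteCategory.congr_hom
        (NatTrans.congr_app (levelMap_naturality (SimplexCategory.δ i) g) m) x).symm
    exact ⟨⟨x, key 0 a ((ψ.vertices_one_one m x).symm.trans (congrFun hy 1)) z.2.1,
      key 1 b ((ψ.vertices_one_zero m x).symm.trans (congrFun hy 0)) z.2.2⟩, Subtype.ext hx⟩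

/-- With the total relation every edge downstairs lifts between any chosen lifts of its endpoints,
so zigzags lift. Surjectivity of `f` provides lifts of the vertices. -/
theorem _root_.TrackCat.IsVertexPullback.bijective_mapπ₀ {K' K : SSet.{u}} {g : K' ⟶ K}
    {ψ : K'.obj (op (.mk 0)) → Y} {φ : K.obj (op (.mk 0)) → D}
    (h : IsVertexPullback g (fun _ _ => True) f ψ φ) (hf : Function.Surjective f) :
    Function.Bijective (SSet.mapπ₀ g) := by
  have hs (z : K.obj (op (.mk 0))) : ∃ x, g.app _ x = z := by
    obtain ⟨y, hy⟩ := hf (φ z)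
    obtain ⟨x, hx, -⟩ := h.lift z (fun _ => y) (fun i => by rw [vert_zero, hy])
      fun _ _ => trivial
    exact ⟨x, hx⟩
  have lift {a b : K'.obj (op (.mk 0))} (e : K.Edge (g.app _ a) (g.app _ b)) :
      SSet.π₀.mk a = SSet.π₀.mk b :=
    SSet.π₀.sound (h.exists_edge equivalence_true e trivial).choose
  refine ⟨fun x x' hx => ?_, fun z => ?_⟩
  · obtain ⟨x, rfl⟩ := SSet.π₀.mk_surjective x
    obtain ⟨x', rfl⟩ := SSet.π₀.mk_surjective x'
    let Q : SSet.π₀ K → Prop := SSet.π₀.lift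
      (fun a => ∀ w, g.app _ w = a → SSet.π₀.mk w = SSet.π₀.mk x')
      fun a b e => propext ⟨fun H w hw => by
          subst hw
          obtain ⟨w', rfl⟩ := hs a
          exact (lift e).symm.trans (H w' rfl),
        fun H w hw => by
          subst hw
          obtain ⟨w', rfl⟩ := hs b
          exact (lift e).trans (H w' rfl)⟩
    -- Two lifts of one vertex, possibly with different labels, are joined by a lift of the identity
    -- edge.
    have hQ : Q (SSet.π₀.mk (g.app _ x')) := fun w hw => lift (hw ▸ SSet.Edge.id _)
    have hx : SSet.π₀.mk (g.app _ x) = SSet.π₀.mk (g.app _ x') := hx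
    rw [← hx] at hQ
    exact hQ x rfl
  · obtain ⟨z, rfl⟩ := SSet.π₀.mk_surjective z
    obtain ⟨x, rfl⟩ := hs z
    exact ⟨SSet.π₀.mk x, rfl⟩

/-- Truncation preserves the situation with the same `f`, so the induction descends to dimension
one. Surjectivity of `f` enters only there, through components. -/
theorem isEquiv : {n : ℕ} → {P X : MSet.{u} (n + 1)} → {g : P ⟶ X} →
    {ψ : Lab ((level (.mk 0)).obj P) Y} → {φ : Lab ((level (.mk 0)).obj X) D} →
    IsVBC g f ψ φ → Function.Surjective f → IsEquiv (n + 1) g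
  | 0, _, _, _, _, _, h, hf => ⟨fun a b => IsEquiv.of_bijective (h.bijective_homFibMap a b),
      fun m => (h.firstLine m.unop).bijective_mapπ₀ hf⟩
  | _ + 1, _, _, _, _, _, h, hf => ⟨fun a b => IsEquiv.of_bijective (h.bijective_homFibMap a b),
      h.trunc.isEquiv hf⟩

end IsVBC

/-! ### Discretization and products; composition in the discretized category -/

theorem lastToDisc_tensor : (n : ℕ) → (Z W : MSet.{u} (n + 1)) → (m : Idx (n + 1)) →
    (z : Z.obj (op m)) → (w : W.obj (op m)) →
    lastToDisc n (Z ⊗ W) m (z, w) = (Functor.LaxMonoidal.μ (trunc n) Z W).app _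
      (lastToDisc n Z m z, lastToDisc n W m w)
  | 0, _, _, _, _, _ => rfl
  | n + 1, Z, W, m, z, w => lastToDisc_tensor n ((level m.1).obj Z) ((level m.1).obj W) m.2 z w

/-- Monoidality of `γ` is what allows composition in `DiscZero` to be computed on representing
multisimplices. -/
theorem discMap_tensor : (n : ℕ) → (Z W : MSet.{u} n) → (m : Idx n) →
    (z : Z.obj (op m)) → (w : W.obj (op m)) →
    discMap n (Z ⊗ W) m (z, w) = Functor.LaxMonoidal.μ (discF n) Z W
      (discMap n Z m z, discMap n W m w)
  | 0, _, _, _, _, _ => rfl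
  | n + 1, Z, W, m, z, w => by
    refine (congrArg (discMap n ((trunc n).obj (Z ⊗ W)) _) (lastToDisc_tensor n Z W m z w)).trans ?_
    refine (discMap_app n (Functor.LaxMonoidal.μ (trunc n) Z W) _ _).trans ?_
    exact congrArg _ (discMap_tensor n ((trunc n).obj Z) ((trunc n).obj W) _ _ _)

theorem lastToDisc_unit : (n : ℕ) → (m : Idx (n + 1)) →
    lastToDisc n (𝟙_ (MSet.{u} (n + 1))) m PUnit.unit =
      (Functor.LaxMonoidal.ε (trunc.{u} n)).app _ PUnit.unit
  | 0, _ => rfl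
  | n + 1, m => lastToDisc_unit n m.2

theorem discMap_unit : (n : ℕ) → (m : Idx n) → discMap n (𝟙_ (MSet.{u} n)) m PUnit.unit =
      Functor.LaxMonoidal.ε (discF.{u} n) PUnit.unit
  | 0, _ => rfl
  | n + 1, m => by
    refine (congrArg (discMap n ((trunc n).obj (𝟙_ _)) _) (lastToDisc_unit n m)).trans ?_
    refine (discMap_app n (Functor.LaxMonoidal.ε (trunc n)) _ _).trans ?_
    exact congrArg _ (discMap_unit n _)

namespace NTrack

variable {n : ℕ} {O : Type u} (X : NTrack.{u} (n + 1) O)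

/-- The morphism of the category `X.DiscZero` represented by a multisimplex of a mapping object. -/
def arrow {a b : O} {m : Idx n} (x : (X.enr.Hom a b).obj (op ((.mk 0, m) : Idx (n + 1)))) :
    Quiver.Hom (V := X.DiscZero) a b :=
  discMap n ((level (.mk 0)).obj (X.enr.Hom a b)) m x

theorem arrow_comp {a b c : O} {m : Idx n}
    (x : (X.enr.Hom a b).obj (op ((.mk 0, m) : Idx (n + 1))))
    (y : (X.enr.Hom b c).obj (op ((.mk 0, m) : Idx (n + 1)))) :
    X.arrow ((X.enr.comp a b c).app _ (x, y)) =
      CategoryStruct.comp (obj := X.DiscZero) (X.arrow x) (X.arrow y) := by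
  refine (discMap_app n ((level (.mk 0)).map (X.enr.comp a b c)) m _).trans ?_
  refine (congrArg _ (discMap_tensor n ((level (.mk 0)).obj (X.enr.Hom a b))
    ((level (.mk 0)).obj (X.enr.Hom b c)) m x y)).trans ?_
  let _ := X.enr
  -- Taking a level is strictly monoidal, so the structure map of the composite functor is that of
  -- `discF`.
  have key : Functor.LaxMonoidal.μ (discZeroF n) (X.enr.Hom a b) (X.enr.Hom b c) =
      Functor.LaxMonoidal.μ (discF n) _ _ := by
    refine (Functor.LaxMonoidal.comp_μ _ _ _ _).trans ?_
    exact (congrArg (_ ≫ ·) ((discF n).map_id _)).trans (Category.comp_id _)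
  exact congrArg ((discZeroF n).map (X.enr.comp a b c)) (ConcreteCategory.congr_hom key
    (show (discZeroF n).obj (X.enr.Hom a b) ⊗ (discZeroF n).obj (X.enr.Hom b c) from
      (X.arrow x, X.arrow y))).symm

theorem arrow_id (a : O) (m : Idx n) :
    X.arrow ((X.enr.id a).app (op ((.mk 0, m) : Idx (n + 1))) PUnit.unit) =
      CategoryStruct.id (obj := X.DiscZero) a := by
  refine (discMap_app n ((level (.mk 0)).map (X.enr.id a)) m _).trans ?_
  refine (congrArg _ (discMap_unit n m)).trans ?_
  let _ := X.enr
  have key : Functor.LaxMonoidal.ε (discZeroF.{u} n) = Functor.LaxMonoidal.ε (discF n) := by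
    refine (Functor.LaxMonoidal.comp_ε _ _).trans ?_
    exact (congrArg (_ ≫ ·) ((discF n).map_id _)).trans (Category.comp_id _)
  exact congrArg ((discZeroF n).map (X.enr.id a))
    (ConcreteCategory.congr_hom key PUnit.unit).symm

end NTrack

theorem Lab.vertices_map_app {n : ℕ} {X : MSet.{u} (n + 1)} {D : Type u}
    (φ : Lab ((TrackCat.level (.mk 0)).obj X) D) {m m' : (Idx (n + 1))ᵒᵖ} (θ : m ⟶ m')
    (x : X.obj m) (i) : (φ.vertices m'.unop.1).lab (op m'.unop.2) (X.map θ x) i =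
      (φ.vertices m.unop.1).lab (op m.unop.2) x (θ.unop.1.toOrderHom i) := by
  refine Eq.trans (congrArg (φ.lab (op m'.unop.2)) ?_) (φ.lab_map (Quiver.Hom.op θ.unop.2) _)
  refine (ConcreteCategory.congr_hom (X.map_comp _ _) x).symm.trans
    (Eq.trans ?_ (ConcreteCategory.congr_hom (X.map_comp _ _) x))
  refine congrArg (fun g => X.map (Quiver.Hom.op g) x) (Prod.ext ?_ ?_)
  · ext j
    rfl
  · exact (Category.id_comp _).trans (Category.comp_id _).symm

/-! ### Construction of the pullback -/

/-- The pullback of `X` along a map of sets, applied to the vertices in the first direction. -/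
@[reducible] def pullVertices {n : ℕ} (X : MSet.{u} (n + 1)) {Y D : Type u}
    (φ : Lab ((level (.mk 0)).obj X) D) (f : Y → D) : MSet.{u} (n + 1) where
  obj m := {p : X.obj m × (Fin (m.unop.1.len + 1) → Y) //
    (φ.vertices m.unop.1).lab (op m.unop.2) p.1 = fun i => f (p.2 i)}
  map {m m'} θ := TypeCat.ofHom fun p => ⟨(X.map θ p.1.1, fun i => p.1.2 (θ.unop.1.toOrderHom i)), by
    funext i
    exact (φ.vertices_map_app θ p.1.1 i).trans (congrFun p.2 (θ.unop.1.toOrderHom i))⟩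
  map_id m := by
    refine ConcreteCategory.hom_ext _ _ fun p => ?_
    refine Subtype.ext ?_
    refine Prod.ext ?_ rfl
    exact ConcreteCategory.congr_hom (X.map_id m) p.1.1
  map_comp θ η := by
    refine ConcreteCategory.hom_ext _ _ fun p => ?_
    refine Subtype.ext ?_
    refine Prod.ext ?_ rfl
    exact ConcreteCategory.congr_hom (X.map_comp θ η) p.1.1

/-- The projection of the pullback. -/
def pullVerticesFst {n : ℕ} (X : MSet.{u} (n + 1)) {Y D : Type u}
    (φ : Lab ((level (.mk 0)).obj X) D) (f : Y → D) : pullVertices X φ f ⟶ X where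
  app m := TypeCat.ofHom fun p => p.1.1
  naturality _ _ _ := rfl

/-- The labelling of the vertices of the pullback. -/
@[reducible] def pullVerticesLab {n : ℕ} (X : MSet.{u} (n + 1)) {Y D : Type u}
    (φ : Lab ((level (.mk 0)).obj X) D) (f : Y → D) :
    Lab ((level (.mk 0)).obj (pullVertices X φ f)) Y where
  lab m p := p.1.2 0
  lab_map _ _ := rfl

theorem isVBC_pullVertices {n : ℕ} (X : MSet.{u} (n + 1)) {Y D : Type u}
    (φ : Lab ((level (.mk 0)).obj X) D) (f : Y → D) :
    IsVBC (pullVerticesFst X φ f) f (pullVerticesLab X φ f) φ := fun k =>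
  { comm := fun m p => p.2
    inj := fun m p p' h₁ h₂ => Subtype.ext (Prod.ext h₁ h₂)
    lift := fun m z y h => ⟨⟨(z, y), h⟩, rfl, rfl⟩ }

/-! ### The free resolution and its projection -/

namespace NTrack

variable {n : ℕ} {O : Type u} (X : NTrack.{u} (n + 1) O)

/-- The paths of arrows of the category `X.DiscZero`. -/
abbrev Walk (a b : O) : Type u := Quiver.Path (V := X.DiscZero) a b

/-- Evaluation of paths in the category `X.DiscZero`. -/
def eval {a b : O} (p : X.Walk a b) : (discF n).obj ((level (.mk 0)).obj (X.enr.Hom a b)) :=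
  composePath (C := X.DiscZero) p

/-- The mapping objects of the free resolution. -/
@[reducible] def freeHom (a b : O) : MSet.{u} (n + 1) :=
  pullVertices (X.enr.Hom a b) (discMapLab _) (X.eval (a := a) (b := b))

/-- Composition in the free resolution. -/
def freeComp (a b c : O) : X.freeHom a b ⊗ X.freeHom b c ⟶ X.freeHom a c where
  app m := TypeCat.ofHom fun p : (X.freeHom a b).obj m × (X.freeHom b c).obj m =>
    ⟨((X.enr.comp a b c).app m (p.1.1.1, p.2.1.1), fun i => (p.1.1.2 i).comp (p.2.1.2 i)), by
      funext i
      -- Compatibility with labels is functoriality of evaluation, checked at each vertex `i`, where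
      -- composition in `X` restricts to composition in `X.DiscZero`.
      refine Eq.trans ?_ (composePath_comp (C := X.DiscZero) (p.1.1.2 i) (p.2.1.2 i)).symm
      refine Eq.trans ?_ (congrArg₂ (CategoryStruct.comp (obj := X.DiscZero))
        (congrFun p.1.2 i) (congrFun p.2.2 i))
      refine Eq.trans ?_ (X.arrow_comp _ _)
      exact congrArg X.arrow (ConcreteCategory.congr_hom ((X.enr.comp a b c).naturality _) _).symm⟩
  naturality m m' θ := by
    refine ConcreteCategory.hom_ext _ _ fun p => ?_
    refine Subtype.ext ?_
    refine Prod.ext ?_ rfl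
    exact ConcreteCategory.congr_hom ((X.enr.comp a b c).naturality θ)
      (show (X.enr.Hom a b ⊗ X.enr.Hom b c).obj m from (p.1.1.1, p.2.1.1))

/-- Identities in the free resolution. -/
def freeId (a : O) : 𝟙_ (MSet.{u} (n + 1)) ⟶ X.freeHom a a where
  app m := TypeCat.ofHom fun _ =>
    ⟨((X.enr.id a).app m PUnit.unit, fun _ => Quiver.Path.nil), by
      funext i
      refine Eq.trans ?_ (X.arrow_id a m.unop.2)
      exact congrArg X.arrow (ConcreteCategory.congr_hom ((X.enr.id a).naturality _) _).symm⟩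
  naturality m m' θ := by
    refine ConcreteCategory.hom_ext _ _ fun p => ?_
    refine Subtype.ext ?_
    refine Prod.ext ?_ rfl
    exact ConcreteCategory.congr_hom ((X.enr.id a).naturality θ) PUnit.unit

/-- The free resolution of an `(n + 1)`-track category. -/
def free : NTrack.{u} (n + 1) O where
  enr :=
    { Hom := X.freeHom
      id := X.freeId
      comp := X.freeComp
      id_comp := fun a b => by
        refine NatTrans.ext (funext fun m => ConcreteCategory.hom_ext _ _ fun p => ?_)
        refine Subtype.ext ?_
        refine Prod.ext ?_ (funext fun i => Quiver.Path.nil_comp _)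
        exact ConcreteCategory.congr_hom (NatTrans.congr_app (X.enr.id_comp a b) m) p.1.1
      comp_id := fun a b => by
        refine NatTrans.ext (funext fun m => ConcreteCategory.hom_ext _ _ fun p => ?_)
        refine Subtype.ext ?_
        refine Prod.ext ?_ (funext fun i => Quiver.Path.comp_nil _)
        exact ConcreteCategory.congr_hom (NatTrans.congr_app (X.enr.comp_id a b) m) p.1.1
      assoc := fun a b c d => by
        refine NatTrans.ext (funext fun m => ConcreteCategory.hom_ext _ _ fun p => ?_)
        refine Subtype.ext ?_
        refine Prod.ext ?_ (funext fun i => Quiver.Path.comp_assoc _ _ _)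
        exact ConcreteCategory.congr_hom (NatTrans.congr_app (X.enr.assoc a b c d) m)
          (show (X.enr.Hom a b ⊗ X.enr.Hom b c ⊗ X.enr.Hom c d).obj m from
            (p.1.1.1, p.2.1.1.1, p.2.2.1.1)) }
  wg a b := ⟨(isVBC_pullVertices _ _ _).isGCatWG (X.wg a b).1,
    (isVBC_pullVertices _ _ _).isNFoldGpd (X.wg a b).2⟩

/-- The projection of the free resolution. -/
def freeProj : X.free.Hom X where
  map a b := pullVerticesFst _ _ _
  map_id a := rfl
  map_comp a b c := rfl

theorem surjective_eval (a b : O) : Function.Surjective (X.eval (a := a) (b := b)) := fun d =>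
  ⟨Quiver.Hom.toPath (V := X.DiscZero) d, composePath_toPath (C := X.DiscZero) d⟩

theorem isNEquiv_freeProj : X.freeProj.IsNEquiv := fun a b =>
  (isVBC_pullVertices _ _ _).isEquiv (X.surjective_eval a b)

/-- The path underlying a morphism of `X.free.DiscZero`. -/
def path {a b : O} (d : (discF n).obj ((level (.mk 0)).obj (X.free.enr.Hom a b))) : X.Walk a b :=
  (pullVerticesLab (X.enr.Hom a b) (discMapLab _) (X.eval (a := a) (b := b))).disc d

/-- The labelling of `X(a,b)₀` by its own discretization induces the identity, so the discretization
of the pullback is the pullback of an identity along evaluation. -/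
theorem bijective_path (a b : O) : Function.Bijective (X.path (a := a) (b := b)) := by
  have h := isVBC_pullVertices (X.enr.Hom a b) (discMapLab _) (X.eval (a := a) (b := b))
  refine ⟨h.disc_injective fun d e hde => ?_, fun y => ?_⟩
  · rwa [disc_discMapLab, disc_discMapLab] at hde
  · obtain ⟨x, -, hx⟩ := h.zero.disc_lift (X.eval y) y (disc_discMapLab _ _)
    exact ⟨x, hx⟩

theorem path_arrow {a b : O} {m : Idx n}
    (x : (X.free.enr.Hom a b).obj (op ((.mk 0, m) : Idx (n + 1)))) :
    X.path (X.free.arrow x) = x.1.2 0 :=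
  Lab.disc_discMap _ _ _

end NTrack

/-! ### Freeness of the discretized category -/

theorem exists_weakly_initial : (n : ℕ) → ∃ z : Idx n, ∀ m, Nonempty (z ⟶ m)
  | 0 => ⟨⟨⟨⟩⟩, fun _ => ⟨𝟙 _⟩⟩
  | n + 1 => by
    obtain ⟨z, hz⟩ := exists_weakly_initial n
    exact ⟨(.mk 0, z), fun m => (hz m.2).map fun f => (SimplexCategory.const _ _ 0, f)⟩

namespace NTrack

variable {n : ℕ} {O : Type u} (X : NTrack.{u} (n + 1) O)

/-- A single multi-index represents all morphisms, because elements can be restricted along maps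
from a weakly initial index without changing their class. Two composable morphisms can then be
composed on representatives. -/
theorem exists_arrow : ∃ z : Idx n, ∀ {a b : O}
    (d : (discF n).obj ((level (.mk 0)).obj (X.enr.Hom a b))),
    ∃ x : (X.enr.Hom a b).obj (op ((.mk 0, z) : Idx (n + 1))), X.arrow x = d := by
  obtain ⟨z, hz⟩ := exists_weakly_initial n
  refine ⟨z, fun {a b} d => ?_⟩
  obtain ⟨m, x, rfl⟩ := exists_discMap n _ d
  obtain ⟨e⟩ := hz m
  exact ⟨((level (.mk 0)).obj (X.enr.Hom a b)).map e.op x, discMap_map n _ e x⟩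

theorem path_comp {a b c : O} (d : Quiver.Hom (V := X.free.DiscZero) a b)
    (e : Quiver.Hom (V := X.free.DiscZero) b c) :
    X.path (CategoryStruct.comp (obj := X.free.DiscZero) d e) =
      Quiver.Path.comp (X.path d) (X.path e) := by
  obtain ⟨z, hz⟩ := X.free.exists_arrow
  obtain ⟨x, rfl⟩ := hz d
  obtain ⟨y, rfl⟩ := hz e
  rw [← X.free.arrow_comp, path_arrow, path_arrow, path_arrow]
  rfl

theorem path_id (a : O) :
    X.path (CategoryStruct.id (obj := X.free.DiscZero) a) = Quiver.Path.nil := by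
  obtain ⟨z, -⟩ := X.free.exists_arrow
  rw [← X.free.arrow_id a z, path_arrow]
  rfl

theorem isFreeCategory_free : IsFreeCategory X.free.DiscZero := by
  -- The free generators are all the morphisms of `X.DiscZero`, that is, the paths of length one.
  let e (a b : O) := Equiv.ofBijective _ (X.bijective_path a b)
  let F : Paths X.DiscZero ⥤ X.free.DiscZero :=
    { obj := fun a => a
      map := fun {a b} p => (e a b).symm p
      map_id := fun a => (Equiv.symm_apply_eq _).2 (X.path_id a).symm
      map_comp := fun {a b c} p q => (Equiv.symm_apply_eq _).2 <| by
        refine Eq.trans ?_ (X.path_comp _ _).symm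
        exact (congrArg₂ Quiver.Path.comp ((e a b).apply_symm_apply p)
          ((e b c).apply_symm_apply q)).symm }
  exact ⟨X.DiscZero, inferInstance, F, ⟨fun {a b} => (e a b).symm.surjective⟩,
    ⟨fun {a b} => (e a b).symm.injective⟩, Function.bijective_id⟩

end NTrack

end TrackCat

theorem lemma4p6 (n : ℕ) (O : Type u) (X : TrackCat.NTrack.{u} (n + 2) O) :
    ∃ (S : TrackCat.NTrack.{u} (n + 2) O) (v : S.Hom X),
      TrackCat.IsFreeCategory S.DiscZero ∧ v.IsNEquiv :=
  ⟨X.free, X.freeProj, X.isFreeCategory_free, X.isNEquiv_freeProj⟩
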